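/- A (finite-dimensional, single-prover) quantum prover-verifier interaction with $r\ge 1$ rounds is given by nonzero finite-dimensional complex Hilbert spaces $\mathcal X_i,\mathcal Y_i,\mathcal Z_i$ ($1\le i\le r$), a density operator $\rho$ on $\mathcal X_1\otimes\mathcal Z_1$ (Alice's first message and memory), quantum channels $\Psi_i$ ($2\le i\le r$) from operators on $\mathcal Y_{i-1}\otimes\mathcal Z_{i-1}$ to operators on $\mathcal X_i\otimes\mathcal Z_i$ (Alice's later actions), and a binary POVM $\{P_0,P_1\}$ on $\mathcal Y_r\otimes\mathcal Z_r$, where $1$ is the winning outcome for the prover Bob. A strategy of Bob consists of finite-dimensional memory spaces $\mathcal W_i$, a channel from $\mathcal X_1$ to $\mathcal Y_1\otimes\mathcal W_1$, and channels from $\mathcal X_i\otimes\mathcal W_{i-1}$ to $\mathcal Y_i\otimes\mathcal W_i$ for $2\le i\le r$ (the last memory is discarded). Bob's optimal winning probability is the supremum over all strategies of the probability of outcome $1$. A quantum interactive proof system assigns to each input string $s$ such an interaction $V_s$; let $p(s)$ be Bob's optimal winning probability in $V_s$. For a pair $(L_{yes},L_{no})$ of sets of strings it has soundness $a$ if $p(s)\le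 a$ for all $s\in L_{no}$, and completeness $b$ if $p(s)\ge b$ for all $s\in L_{yes}$; its soundness and completeness errors are then $a$ and $1-b$. Let $0\le a<b\le 1$. There is a constant $C>0$, depending only on $a$ and $b$, such that the following holds for every quantum interactive proof system with soundness $a$ and completeness $b$, every $\varepsilon\in(0,1)$ and every integer $n\ge C\log(1/\varepsilon)$ (in particular for $n=\lceil C\log(1/\varepsilon)\rceil$). Run $n$ instances of the protocol in parallel, with Alice acting identically and independently in each instance and Bob free to act jointly on all of them, and accept if and only if Bob wins at least $\lceil n(a+b)/2\rceil$ of the $n$ instances. The resulting proof system, for the same $(L_{yes},L_{no})$, has soundness at most $\varepsilon$ and completeness at least $1-\varepsilon$; that is, $O(\log(1/\varepsilon))$ parallel instances bring both errors down to $\varepsilon$. -/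

import Mathlib

namespace QIP

open scoped Matrix ComplexOrder

noncomputable section

/-! Finite-dimensional quantum information, in coordinates.  A nonzero finite-dimensional Hilbert
space is `ℂ^A` for a finite nonempty index type `A` (an orthonormal basis); operators on it are
`Matrix A A ℂ`; the tensor product of `ℂ^A` and `ℂ^B` is `ℂ^(A × B)`; and the `n`-th tensor power
of `ℂ^A` is `ℂ^(Fin n → A)`. -/

/-- The map `Φ ⊗ id` on operators on `ℂ^A ⊗ ℂ^W`: `Φ` is applied to the first tensor factor. -/
def ampl {A B : Type} (Φ : Matrix A A ℂ →ₗ[ℂ] Matrix B B ℂ) (W : Type)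
    (M : Matrix (A × W) (A × W) ℂ) : Matrix (B × W) (B × W) ℂ :=
  Matrix.of fun p q => Φ (Matrix.of fun a a' => M (a, p.2) (a', q.2)) p.1 q.1

/-- Complete positivity: `Φ ⊗ id_W` preserves positive semidefiniteness for every
finite-dimensional `W`. -/
def IsCompletelyPositive {A B : Type} (Φ : Matrix A A ℂ →ₗ[ℂ] Matrix B B ℂ) : Prop :=
  ∀ (W : Type) [Fintype W] (M : Matrix (A × W) (A × W) ℂ),
    M.PosSemidef → (ampl Φ W M).PosSemidef

/-- A quantum channel from `ℂ^A` to `ℂ^B`: a completely positive trace-preserving linear map. -/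
structure Channel (A B : Type) [Fintype A] [Fintype B] where
  map : Matrix A A ℂ →ₗ[ℂ] Matrix B B ℂ
  completelyPositive : IsCompletelyPositive map
  tracePreserving : ∀ M, (map M).trace = M.trace

/-- Density operators: positive semidefinite with unit trace. -/
def IsDensity {A : Type} [Fintype A] (ρ : Matrix A A ℂ) : Prop :=
  ρ.PosSemidef ∧ ρ.trace = 1

/-- Binary POVMs `{P 0, P 1}`. -/
def IsBinaryPOVM {A : Type} [DecidableEq A] (P : Fin 2 → Matrix A A ℂ) : Prop :=
  (∀ o, (P o).PosSemidef) ∧ P 0 + P 1 = 1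

/-- The partial trace over the second tensor factor. -/
def partialTrace {A W : Type} [Fintype W] (M : Matrix (A × W) (A × W) ℂ) : Matrix A A ℂ :=
  Matrix.of fun a a' => ∑ w, M (a, w) (a', w)

/-- Reordering of the tensor factors `A ⊗ B ⊗ C` as `A ⊗ C ⊗ B`. -/
def swapLast {A B C : Type} (M : Matrix ((A × B) × C) ((A × B) × C) ℂ) :
    Matrix ((A × C) × B) ((A × C) × B) ℂ :=
  M.submatrix (fun p => ((p.1.1, p.2), p.1.2)) (fun p => ((p.1.1, p.2), p.1.2))

/-! ### Prover-verifier interactions -/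

/-- A prover-verifier interaction with `r = m + 1` messages from Alice (the verifier) to Bob (the
prover) and `m + 1` messages from Bob to Alice, indexed from `0`.  `X i`, `Y i`, `Z i` are the
spaces of Alice's `i`-th message, of Bob's `i`-th message, and of Alice's memory after she sends
her `i`-th message. `ρ` is the joint state of Alice's first message and memory, `Ψ i` is the channel
that Alice applies to Bob's `i`-th message and her memory, and `P` is her final measurement, with
`P 1` the winning outcome for Bob. -/
structure Interaction where
  m : ℕ
  X : Fin (m + 1) → Type
  Y : Fin (m + 1) → Type
  Z : Fin (m + 1) → Type
  [fintypeX : ∀ i, Fintype (X i)]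
  [fintypeY : ∀ i, Fintype (Y i)]
  [fintypeZ : ∀ i, Fintype (Z i)]
  [decidableEqX : ∀ i, DecidableEq (X i)]
  [decidableEqY : ∀ i, DecidableEq (Y i)]
  [decidableEqZ : ∀ i, DecidableEq (Z i)]
  [nonemptyX : ∀ i, Nonempty (X i)]
  [nonemptyY : ∀ i, Nonempty (Y i)]
  [nonemptyZ : ∀ i, Nonempty (Z i)]
  ρ : Matrix (X 0 × Z 0) (X 0 × Z 0) ℂ
  ρ_density : IsDensity ρ
  Ψ : ∀ i : Fin m, Channel (Y i.castSucc × Z i.castSucc) (X i.succ × Z i.succ)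
  P : Fin 2 → Matrix (Y (Fin.last m) × Z (Fin.last m)) (Y (Fin.last m) × Z (Fin.last m)) ℂ
  P_povm : IsBinaryPOVM P

attribute [instance] Interaction.fintypeX Interaction.fintypeY Interaction.fintypeZ
  Interaction.decidableEqX Interaction.decidableEqY Interaction.decidableEqZ
  Interaction.nonemptyX Interaction.nonemptyY Interaction.nonemptyZ

/-- A strategy for Bob: memory spaces `W i` of arbitrary finite dimension, a channel producing his
first message and memory from Alice's first message, and channels producing each later message and
memory from Alice's message and his previous memory. -/
structure Strategy (V : Interaction) where
  W : Fin (V.m + 1) → Type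
  [fintypeW : ∀ i, Fintype (W i)]
  first : Channel (V.X 0) (V.Y 0 × W 0)
  next : ∀ i : Fin V.m, Channel (V.X i.succ × W i.castSucc) (V.Y i.succ × W i.succ)

attribute [instance] Strategy.fintypeW

namespace Strategy

variable {V : Interaction} (B : Strategy V)

/-- The joint state of Bob's `i`-th message, Alice's memory and Bob's memory, right after Bob sends
his `i`-th message. -/
def state (i : Fin (V.m + 1)) :
    Matrix ((V.Y i × V.Z i) × B.W i) ((V.Y i × V.Z i) × B.W i) ℂ :=
  Fin.induction
    (motive := fun i => Matrix ((V.Y i × V.Z i) × B.W i) ((V.Y i × V.Z i) × B.W i) ℂ)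
    (swapLast (ampl B.first.map (V.Z 0) V.ρ))
    (fun i σ => swapLast (ampl (B.next i).map (V.Z i.succ)
      (swapLast (ampl (V.Ψ i).map (B.W i.castSucc) σ))))
    i

/-- The probability that the final outcome is `1` (Bob wins), when Bob uses the strategy `B`. -/
def winProb : ℝ :=
  (V.P 1 * partialTrace (B.state (Fin.last V.m))).trace.re

/-! The set of winning probabilities is nonempty and contained in `[0, 1]`, so that its supremum
below is a genuine one. -/

theorem ampl_trace {A B W : Type} [Fintype A] [Fintype B] [Fintype W] (Φ : Channel A B)
    (M : Matrix (A × W) (A × W) ℂ) : (ampl Φ.map W M).trace = M.trace := by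
  have h := fun w => Φ.tracePreserving (Matrix.of fun a a' => M (a, w) (a', w))
  simp only [Matrix.trace, Matrix.diag_apply, Matrix.of_apply] at h
  simp only [Matrix.trace, Matrix.diag_apply, ampl, Matrix.of_apply, Fintype.sum_prod_type]
  rw [Finset.sum_comm, Finset.sum_comm (f := fun a w => M (a, w) (a, w))]
  exact Finset.sum_congr rfl fun w _ => h w

theorem isDensity_ampl {A B W : Type} [Fintype A] [Fintype B] [Fintype W] (Φ : Channel A B)
    {M : Matrix (A × W) (A × W) ℂ} (h : IsDensity M) : IsDensity (ampl Φ.map W M) :=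
  ⟨Φ.completelyPositive W M h.1, (ampl_trace Φ M).trans h.2⟩

theorem isDensity_swapLast {A B C : Type} [Fintype A] [Fintype B] [Fintype C]
    {M : Matrix ((A × B) × C) ((A × B) × C) ℂ} (h : IsDensity M) : IsDensity (swapLast M) := by
  refine ⟨h.1.submatrix _, ?_⟩
  rw [← h.2]
  simp only [Matrix.trace, Matrix.diag_apply, swapLast, Matrix.submatrix_apply,
    Fintype.sum_prod_type]
  exact Finset.sum_congr rfl fun a _ => Finset.sum_comm

theorem isDensity_partialTrace {A W : Type} [Fintype A] [Fintype W]
    {M : Matrix (A × W) (A × W) ℂ} (h : IsDensity M) : IsDensity (partialTrace M) := by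
  constructor
  · have : partialTrace M = ∑ w, M.submatrix (fun a => (a, w)) (fun a => (a, w)) := by
      ext a a'
      simp [partialTrace, Matrix.sum_apply]
    rw [this]
    exact Matrix.posSemidef_sum _ fun w _ => h.1.submatrix _
  · rw [← h.2]
    simp [Matrix.trace, partialTrace, Fintype.sum_prod_type]

theorem state_isDensity (i : Fin (V.m + 1)) : IsDensity (B.state i) := by
  induction i using Fin.induction with
  | zero => exact isDensity_swapLast (isDensity_ampl B.first V.ρ_density)
  | succ i ih => exact isDensity_swapLast (isDensity_ampl (B.next i)
      (isDensity_swapLast (isDensity_ampl (V.Ψ i) ih)))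

theorem winProb_mem : B.winProb ∈ Set.Icc (0 : ℝ) 1 := by
  have h := isDensity_partialTrace (B.state_isDensity (Fin.last V.m))
  have key : ∀ o, 0 ≤ (V.P o * partialTrace (B.state (Fin.last V.m))).trace.re := by
    intro o
    obtain ⟨S, hS⟩ : ∃ S, V.P o = Sᴴ * S := by
      open scoped MatrixOrder in
      exact CStarAlgebra.nonneg_iff_eq_star_mul_self.mp (V.P_povm.1 o).nonneg
    rw [hS, Matrix.mul_assoc, Matrix.trace_mul_comm]
    exact (Complex.nonneg_iff.mp (h.1.mul_mul_conjTranspose_same S).trace_nonneg).1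
  refine ⟨key 1, ?_⟩
  have h1 : (V.P 0 * partialTrace (B.state (Fin.last V.m))).trace.re + B.winProb = 1 := by
    rw [winProb, ← Complex.add_re, ← Matrix.trace_add, ← Matrix.add_mul, V.P_povm.2,
      Matrix.one_mul, h.2, Complex.one_re]
  linarith [key 0]

theorem nonempty_channel (A B : Type) [Fintype A] [Fintype B] [Nonempty B] :
    Nonempty (Channel A B) := by
  classical
  let b : B := Classical.arbitrary B
  refine ⟨⟨(Matrix.traceLinearMap A ℂ ℂ).smulRight (Matrix.single b b 1), fun W _ M hM => ?_,
    fun M => by simp⟩⟩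
  have : ampl ((Matrix.traceLinearMap A ℂ ℂ).smulRight (Matrix.single b b 1)) W M =
      ∑ a, (Matrix.of fun (p : B × W) (q : A × W) => if p.1 = b ∧ q = (a, p.2) then (1 : ℂ) else 0)
        * M *
        (Matrix.of fun (p : B × W) (q : A × W) => if p.1 = b ∧ q = (a, p.2) then (1 : ℂ) else 0)ᴴ
      := by
    ext ⟨p, w⟩ ⟨p', w'⟩
    by_cases h1 : p = b <;> by_cases h2 : p' = b <;>
      simp [ampl, Matrix.sum_apply, Matrix.mul_apply, Matrix.trace, Matrix.single_apply, h1, h2,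
        eq_comm (a := b)]
  rw [this]
  exact Matrix.posSemidef_sum _ fun a _ => hM.mul_mul_conjTranspose_same _

end Strategy

instance (V : Interaction) : Nonempty (Strategy V) :=
  ⟨{ W := fun _ => Unit
     first := (Strategy.nonempty_channel _ _).some
     next := fun _ => (Strategy.nonempty_channel _ _).some }⟩

/-- Bob's optimal probability of obtaining the winning outcome. -/
def Interaction.value (V : Interaction) : ℝ :=
  sSup (Set.range fun B : Strategy V => B.winProb)

theorem Interaction.isLUB_value (V : Interaction) :
    IsLUB (Set.range fun B : Strategy V => B.winProb) V.value :=
  isLUB_csSup (Set.range_nonempty _) ⟨1, by rintro _ ⟨B, rfl⟩; exact B.winProb_mem.2⟩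

/-! ### Tensor powers -/

/-- The tensor product `M 0 ⊗ ⋯ ⊗ M (n - 1)` of operators. -/
def tensor {A : Type} {n : ℕ} (M : Fin n → Matrix A A ℂ) :
    Matrix (Fin n → A) (Fin n → A) ℂ :=
  Matrix.of fun a a' => ∏ j, M j (a j) (a' j)

/-- The tensor power `Φ ⊗ ⋯ ⊗ Φ` of a linear map between operators: the linear map sending each
tensor product `E_{a 0, a' 0} ⊗ ⋯ ⊗ E_{a (n-1), a' (n-1)}` of matrix units to the tensor product
of the operators `Φ E_{a j, a' j}`. -/
def tensorPow {A B : Type} [Fintype A] [DecidableEq A] (n : ℕ)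
    (Φ : Matrix A A ℂ →ₗ[ℂ] Matrix B B ℂ) :
    Matrix (Fin n → A) (Fin n → A) ℂ →ₗ[ℂ] Matrix (Fin n → B) (Fin n → B) ℂ where
  toFun M := ∑ a, ∑ a', M a a' • tensor fun j => Φ (Matrix.single (a j) (a' j) 1)
  map_add' M N := by simp [add_smul, Finset.sum_add_distrib]
  map_smul' c M := by simp [mul_smul, Finset.smul_sum]

theorem tensorPow_tensor {A B : Type} [Fintype A] [DecidableEq A] {n : ℕ}
    (Φ : Matrix A A ℂ →ₗ[ℂ] Matrix B B ℂ) (M : Fin n → Matrix A A ℂ) :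
    tensorPow n Φ (tensor M) = tensor fun j => Φ (M j) := by
  ext b b'
  have h : ∀ j, Φ (M j) (b j) (b' j) =
      ∑ a, ∑ a', M j a a' * Φ (Matrix.single a a' 1) (b j) (b' j) := by
    intro j
    conv_lhs => rw [Matrix.matrix_eq_sum_single (M j)]
    simp only [map_sum, Matrix.sum_apply]
    refine Finset.sum_congr rfl fun a _ => Finset.sum_congr rfl fun a' _ => ?_
    have : Matrix.single a a' (M j a a') = M j a a' • Matrix.single a a' (1 : ℂ) := by
      simp [Matrix.smul_single]
    rw [this, map_smul]; rfl
  simp only [tensor, Matrix.of_apply, h, tensorPow, LinearMap.coe_mk, AddHom.coe_mk,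
    Matrix.sum_apply, Matrix.smul_apply, smul_eq_mul, ← Finset.prod_mul_distrib, Fintype.prod_sum]

theorem exists_kraus {A B : Type} [Fintype A] [DecidableEq A] [Fintype B]
    {Φ : Matrix A A ℂ →ₗ[ℂ] Matrix B B ℂ} (h : IsCompletelyPositive Φ) :
    ∃ K : B × A → Matrix B A ℂ, ∀ a a' b b',
      Φ (Matrix.single a a' 1) b b' = ∑ l, K l b a * star (K l b' a') := by
  classical
  let v : Matrix (A × A) Unit ℂ := Matrix.of fun p _ => if p.1 = p.2 then 1 else 0
  have hv : (v * vᴴ).PosSemidef := Matrix.posSemidef_self_mul_conjTranspose v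
  obtain ⟨S, hS⟩ : ∃ S : Matrix (B × A) (B × A) ℂ, ampl Φ A (v * vᴴ) = Sᴴ * S := by
    have := (h A _ hv)
    open scoped MatrixOrder in
    exact CStarAlgebra.nonneg_iff_eq_star_mul_self.mp this.nonneg
  refine ⟨fun l => Matrix.of fun b a => star (S l (b, a)), fun a a' b b' => ?_⟩
  have h1 := congrFun (congrFun hS (b, a)) (b', a')
  have h2 : (Matrix.of fun x x' => (v * vᴴ) (x, a) (x', a')) = Matrix.single a a' (1 : ℂ) := by
    ext x x'
    simp only [v, Matrix.mul_apply, Matrix.single_apply, Matrix.of_apply,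
      Matrix.conjTranspose_apply, Finset.univ_unique, Finset.sum_singleton]
    by_cases h3 : x = a <;> by_cases h4 : x' = a' <;> 
      simp [h3, h4, Ne.symm]
  simp only [ampl, Matrix.of_apply, h2] at h1
  rw [h1]
  simp [Matrix.mul_apply]

theorem tensorPow_completelyPositive {A B : Type} [Fintype A] [DecidableEq A] [Fintype B] (n : ℕ)
    {Φ : Matrix A A ℂ →ₗ[ℂ] Matrix B B ℂ} (h : IsCompletelyPositive Φ) :
    IsCompletelyPositive (tensorPow n Φ) := by
  classical
  obtain ⟨K, hK⟩ := exists_kraus h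
  intro W _ M hM
  let T : (Fin n → B × A) → Matrix ((Fin n → B) × W) ((Fin n → A) × W) ℂ :=
    fun l => Matrix.of fun p q => if p.2 = q.2 then ∏ j, K (l j) (p.1 j) (q.1 j) else 0
  have hT : ∀ l b w b' w', (T l * M * (T l)ᴴ) (b, w) (b', w') =
      ∑ a, ∑ a', M (a, w) (a', w') *
        ((∏ j, K (l j) (b j) (a j)) * ∏ j, star (K (l j) (b' j) (a' j))) := by
    intro l b w b' w'
    have h1 : ∀ q, (T l * M) (b, w) q = ∑ a, (∏ j, K (l j) (b j) (a j)) * M (a, w) q := by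
      intro q
      simp [T, Matrix.mul_apply, Fintype.sum_prod_type]
    rw [Matrix.mul_apply]
    simp only [h1, Fintype.sum_prod_type]
    simp only [T, Matrix.conjTranspose_apply, Matrix.of_apply, apply_ite star, star_zero,
      star_prod, mul_ite, mul_zero, Finset.sum_ite_eq, Finset.mem_univ, if_true, Finset.sum_mul]
    rw [Finset.sum_comm]
    refine Finset.sum_congr rfl fun a _ => Finset.sum_congr rfl fun a' _ => ?_
    ring
  have : ampl (tensorPow n Φ) W M = ∑ l, T l * M * (T l)ᴴ := by
    ext ⟨b, w⟩ ⟨b', w'⟩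
    simp only [Matrix.sum_apply, hT]
    rw [Finset.sum_comm]
    simp only [ampl, tensorPow, tensor, Matrix.of_apply, LinearMap.coe_mk, AddHom.coe_mk,
      Matrix.sum_apply, Matrix.smul_apply, smul_eq_mul, hK, Fintype.prod_sum,
      Finset.prod_mul_distrib, Finset.mul_sum]
    exact Finset.sum_congr rfl fun a _ => Finset.sum_comm
  rw [this]
  exact Matrix.posSemidef_sum _ fun l _ => hM.mul_mul_conjTranspose_same _

theorem tensor_trace {A : Type} [Fintype A] {n : ℕ} (M : Fin n → Matrix A A ℂ) :
    (tensor M).trace = ∏ j, (M j).trace := by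
  simp [Matrix.trace, tensor, Fintype.prod_sum]

theorem tensorPow_tracePreserving {A B : Type} [Fintype A] [DecidableEq A] [Fintype B] (n : ℕ)
    {Φ : Matrix A A ℂ →ₗ[ℂ] Matrix B B ℂ} (h : ∀ M, (Φ M).trace = M.trace)
    (M : Matrix (Fin n → A) (Fin n → A) ℂ) : (tensorPow n Φ M).trace = M.trace := by
  have h1 : ∀ a a' : Fin n → A, (∏ j, (Matrix.single (a j) (a' j) (1 : ℂ)).trace) =
      if a = a' then 1 else 0 := by
    intro a a'
    split_ifs with hh
    · subst hh; simp
    · obtain ⟨j, hj⟩ := Function.ne_iff.mp hh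
      exact Finset.prod_eq_zero (Finset.mem_univ j) (Matrix.trace_single_eq_of_ne _ _ _ hj)
  simp only [tensorPow, LinearMap.coe_mk, AddHom.coe_mk, Matrix.trace_sum, Matrix.trace_smul,
    tensor_trace, h, h1]
  simp [Matrix.trace]

theorem tensor_posSemidef {A : Type} [Fintype A] {n : ℕ} {M : Fin n → Matrix A A ℂ}
    (h : ∀ j, (M j).PosSemidef) : (tensor M).PosSemidef := by
  classical
  have : ∀ j, ∃ S : Matrix A A ℂ, M j = Sᴴ * S := fun j => by
    open scoped MatrixOrder in
    exact CStarAlgebra.nonneg_iff_eq_star_mul_self.mp (h j).nonneg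
  choose S hS using this
  have : tensor M = (tensor S)ᴴ * tensor S := by
    ext a a'
    simp [tensor, hS, Matrix.mul_apply, Fintype.prod_sum, Finset.prod_mul_distrib]
  rw [this]
  exact Matrix.posSemidef_conjTranspose_mul_self _

/-! ### Parallel repetition with a threshold -/

/-- The identification of `(ℂ^A ⊗ ℂ^B)^{⊗ n}` with `(ℂ^A)^{⊗ n} ⊗ (ℂ^B)^{⊗ n}`. -/
abbrev split (n : ℕ) (A B : Type) : (Fin n → A × B) ≃ (Fin n → A) × (Fin n → B) :=
  Equiv.arrowProdEquivProdArrow (Fin n) (fun _ => A) (fun _ => B)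

/-- Relabelling of the bases of the input and output spaces of a channel. -/
def Channel.reindex {A B A' B' : Type} [Fintype A] [Fintype B] [Fintype A'] [Fintype B']
    (e : A ≃ A') (f : B ≃ B') (Φ : Channel A B) : Channel A' B' where
  map := (Matrix.reindexLinearEquiv ℂ ℂ f f).toLinearMap ∘ₗ Φ.map ∘ₗ
    (Matrix.reindexLinearEquiv ℂ ℂ e.symm e.symm).toLinearMap
  completelyPositive W _ M hM :=
    (Φ.completelyPositive W _ (hM.submatrix (Prod.map e id))).submatrix (Prod.map f.symm id)
  tracePreserving M := by
    have := Φ.tracePreserving (M.submatrix e e)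
    simp only [Matrix.trace, Matrix.diag_apply, Matrix.submatrix_apply] at this
    rw [Equiv.sum_comp e (fun i => M i i)] at this
    simp only [Matrix.trace, Matrix.diag_apply, ← this]
    exact Equiv.sum_comp f.symm (fun i => Φ.map (M.submatrix e e) i i)

/-- `n` copies of a channel acting in parallel. -/
def Channel.pow {A B : Type} [Fintype A] [DecidableEq A] [Fintype B] (n : ℕ) (Φ : Channel A B) :
    Channel (Fin n → A) (Fin n → B) where
  map := tensorPow n Φ.map
  completelyPositive := tensorPow_completelyPositive n Φ.completelyPositive
  tracePreserving := tensorPow_tracePreserving n Φ.tracePreserving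

/-- The measurement that performs `P` independently on each of `n` systems and outputs `1` if and
only if at least `k` of the `n` outcomes equal `1`: the operator for the output `o` is the sum of
`P (w 0) ⊗ ⋯ ⊗ P (w (n - 1))` over the outcome strings `w` that lead to the output `o`. -/
def thresholdPOVM {A : Type} (P : Fin 2 → Matrix A A ℂ) (n k : ℕ) (o : Fin 2) :
    Matrix (Fin n → A) (Fin n → A) ℂ :=
  ∑ w : Fin n → Fin 2 with (o = 1 ↔ k ≤ (Finset.univ.filter fun j => w j = 1).card),
    tensor fun j => P (w j)

theorem thresholdPOVM_isBinaryPOVM {A : Type} [Fintype A] [DecidableEq A]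
    {P : Fin 2 → Matrix A A ℂ} (h : IsBinaryPOVM P) (n k : ℕ) :
    IsBinaryPOVM (thresholdPOVM P n k) := by
  refine ⟨fun o => Matrix.posSemidef_sum _ fun w _ => tensor_posSemidef fun j => h.1 _, ?_⟩
  have h1 : thresholdPOVM P n k 0 + thresholdPOVM P n k 1 =
      ∑ w : Fin n → Fin 2, tensor fun j => P (w j) := by
    rw [← Finset.sum_filter_add_sum_filter_not Finset.univ
      (fun w : Fin n → Fin 2 => ¬ k ≤ (Finset.univ.filter fun j => w j = 1).card)]
    simp [thresholdPOVM]
  have h2 : ∀ a a', P 0 a a' + P 1 a a' = (1 : Matrix A A ℂ) a a' := fun a a' => by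
    rw [← h.2]; rfl
  rw [h1]
  ext a a'
  have h3 := Fintype.prod_sum (fun (j : Fin n) (o : Fin 2) => P o (a j) (a' j))
  simp only [Fin.sum_univ_two, h2] at h3
  simp only [Matrix.sum_apply, tensor, Matrix.of_apply, ← h3]
  by_cases hh : a = a'
  · subst hh; simp
  · obtain ⟨j, hj⟩ := Function.ne_iff.mp hh
    rw [Matrix.one_apply_ne hh]
    exact Finset.prod_eq_zero (Finset.mem_univ j) (Matrix.one_apply_ne hj)

/-- Parallel repetition with a threshold: `n` instances of `V` are run in parallel, with Alice acting
identically and independently in each of them, and Bob wins if and only if he wins at least `k` of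
the `n` instances.  Bob sees it as one interaction, so that he can act jointly on all instances. -/
def Interaction.repeatThreshold (V : Interaction) (n k : ℕ) : Interaction where
  m := V.m
  X i := Fin n → V.X i
  Y i := Fin n → V.Y i
  Z i := Fin n → V.Z i
  ρ := Matrix.reindex (split n _ _) (split n _ _) (tensor fun _ : Fin n => V.ρ)
  ρ_density := by
    refine ⟨(tensor_posSemidef fun _ => V.ρ_density.1).submatrix _, ?_⟩
    have := tensor_trace fun _ : Fin n => V.ρ
    simp only [V.ρ_density.2, Finset.prod_const_one] at this
    rw [← this]
    exact Equiv.sum_comp (split n _ _).symm (fun i => tensor (fun _ : Fin n => V.ρ) i i)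
  Ψ i := ((V.Ψ i).pow n).reindex (split n _ _) (split n _ _)
  P o := Matrix.reindex (split n _ _) (split n _ _) (thresholdPOVM V.P n k o)
  P_povm := by
    obtain ⟨h1, h2⟩ := thresholdPOVM_isBinaryPOVM V.P_povm n k
    refine ⟨fun o => (h1 o).submatrix _, ?_⟩
    have := congrArg (fun M => Matrix.submatrix M (split n _ _).symm (split n _ _).symm) h2
    rw [Matrix.submatrix_one_equiv] at this
    exact this

/-! ### Interactive proof systems -/

/-- A single-prover quantum interactive proof system for the pair `(Lyes, Lno)`: the interaction
depends on an input string. -/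
structure ProofSystem (Str : Type*) where
  Lyes : Set Str
  Lno : Set Str
  V : Str → Interaction

namespace ProofSystem

variable {Str : Type*} (S : ProofSystem Str)

/-- On no-instances Bob wins with optimal probability at most `a`
(the soundness error is at most `a`). -/
def HasSoundness (a : ℝ) : Prop := ∀ s ∈ S.Lno, (S.V s).value ≤ a

/-- On yes-instances Bob wins with optimal probability at least `b`
(the completeness error is at most `1 - b`). -/
def HasCompleteness (b : ℝ) : Prop := ∀ s ∈ S.Lyes, b ≤ (S.V s).value

/-- The proof system for the same `(Lyes, Lno)` in which `n` instances are run in parallel and at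
least `k` of them have to be won. -/
def repeatThreshold (n k : ℕ) : ProofSystem Str where
  Lyes := S.Lyes
  Lno := S.Lno
  V s := (S.V s).repeatThreshold n k

end ProofSystem

end

end QIP

namespace QIP

open scoped Matrix ComplexOrder Kronecker

noncomputable section

/-! ### Positive semidefinite matrices and traces -/

/-! Soundness rests on semidefinite duality applied to an exponential moment. Bob's strategy enters
the winning probability only through the reduced states `r i` of his message and Alice's memory, and
these obey linear constraints: once the message is traced out, Bob's last channel is invisible
(`IsFeasible`). If Alice starts in a pure state and applies isometries, every feasible family comes
from a strategy, because two purifications of the same state are related by a channel on the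
purifying side (`IsPure.exists_strategy`). Any verifier can be made pure by keeping environments in
her memory, at no gain or loss for Bob (`Extension`). Bob's optimum is then the value of a
semidefinite program.

Take as payoff `P 0 + x P 1` with `x ≥ 1`. Its value on one instance is at most `1 + (x - 1) a`, and
strong duality (`exists_isDualFeasible`) gives a dual solution of value `c` for each larger `c`. As
the payoff is positive, so is the dual solution, and operator inequalities between positive
operators survive tensor powers. The `n`-th tensor power is therefore dual feasible for `n`
instances, and joint strategies satisfy `E[x ^ wins] ≤ c ^ n`, essentially as if the instances were
independent (`IsDualFeasible.re_trace_tensor_mul_le`). Markov's inequality and a choice of `x` give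
an exponentially small upper tail.

Completeness needs no duality: independent repetition of a near-optimal strategy makes the wins
independent Bernoulli variables, and a Chernoff bound controls the lower tail. -/

theorem exists_eq_conjTranspose_mul_self {A : Type} [Fintype A] {M : Matrix A A ℂ}
    (h : M.PosSemidef) : ∃ S : Matrix A A ℂ, M = Sᴴ * S := by
  classical
  open scoped MatrixOrder in
  exact CStarAlgebra.nonneg_iff_eq_star_mul_self.mp h.nonneg

theorem trace_mul_nonneg {A : Type} [Fintype A] {M N : Matrix A A ℂ} (hM : M.PosSemidef)
    (hN : N.PosSemidef) : 0 ≤ (M * N).trace := by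
  obtain ⟨S, rfl⟩ := exists_eq_conjTranspose_mul_self hM
  rw [Matrix.mul_assoc, Matrix.trace_mul_comm]
  exact (hN.mul_mul_conjTranspose_same S).trace_nonneg

theorem re_trace_mul_nonneg {A : Type} [Fintype A] {M N : Matrix A A ℂ} (hM : M.PosSemidef)
    (hN : N.PosSemidef) : 0 ≤ (M * N).trace.re :=
  (Complex.nonneg_iff.mp (trace_mul_nonneg hM hN)).1

theorem re_trace_mul_le {A : Type} [Fintype A] {M N R : Matrix A A ℂ} (h : (M - N).PosSemidef)
    (hR : R.PosSemidef) : (N * R).trace.re ≤ (M * R).trace.re := by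
  have := re_trace_mul_nonneg h hR
  rw [Matrix.sub_mul, Matrix.trace_sub, Complex.sub_re] at this
  linarith

/-- Self-duality of the positive cone; rank-one `N` suffice as tests. It turns inequalities between
functionals into operator inequalities. -/
theorem posSemidef_of_re_trace_mul_nonneg {A : Type} [Fintype A] {M : Matrix A A ℂ}
    (hM : M.IsHermitian) (h : ∀ N : Matrix A A ℂ, N.PosSemidef → 0 ≤ (M * N).trace.re) :
    M.PosSemidef := by
  refine Matrix.PosSemidef.of_dotProduct_mulVec_nonneg hM fun x => ?_
  have h1 := h _ (Matrix.posSemidef_vecMulVec_self_star x)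
  rw [Matrix.mul_vecMulVec, Matrix.trace_vecMulVec, dotProduct_comm] at h1
  exact Complex.nonneg_iff.mpr ⟨h1, (hM.im_star_dotProduct_mulVec_self x).symm⟩

/-! ### Tensor powers -/

theorem single_eq_tensor {A : Type} [DecidableEq A] {n : ℕ} (a a' : Fin n → A) :
    Matrix.single a a' (1 : ℂ) = tensor fun j => Matrix.single (a j) (a' j) 1 := by
  ext c c'
  simp only [tensor, Matrix.of_apply, Matrix.single_apply, Finset.prod_ite_zero]
  simp [funext_iff, forall_and]

/-- Matrix units of the tensor power are tensor products of matrix units, so product operators span.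
-/
theorem tensor_linearMap_ext {A E : Type} [Fintype A] [AddCommGroup E] [Module ℂ E] {n : ℕ}
    {f g : Matrix (Fin n → A) (Fin n → A) ℂ →ₗ[ℂ] E}
    (h : ∀ M : Fin n → Matrix A A ℂ, f (tensor M) = g (tensor M)) : f = g := by
  classical
  refine LinearMap.ext fun M => ?_
  rw [Matrix.matrix_eq_sum_single M]
  simp only [map_sum]
  refine Finset.sum_congr rfl fun a _ => Finset.sum_congr rfl fun a' _ => ?_
  rw [show Matrix.single a a' (M a a') = M a a' • Matrix.single a a' (1 : ℂ) by
    simp [Matrix.smul_single], map_smul, map_smul, single_eq_tensor, h]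

theorem tensor_mul {A : Type} [Fintype A] {n : ℕ} (M N : Fin n → Matrix A A ℂ) :
    tensor M * tensor N = tensor fun j => M j * N j := by
  ext a a'
  simp [tensor, Matrix.mul_apply, Fintype.prod_sum, Finset.prod_mul_distrib]

theorem tensor_sum {A ι : Type} [Fintype ι] {n : ℕ} (M : Fin n → ι → Matrix A A ℂ) :
    (tensor fun j => ∑ o, M j o) = ∑ w : Fin n → ι, tensor fun j => M j (w j) := by
  ext a a'
  simp [tensor, Matrix.sum_apply, Fintype.prod_sum]

theorem tensor_smul {A : Type} {n : ℕ} (c : Fin n → ℂ) (M : Fin n → Matrix A A ℂ) :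
    (tensor fun j => c j • M j) = (∏ j, c j) • tensor M := by
  ext a a'
  simp [tensor, Finset.prod_mul_distrib]

/-- Writing `M = N + (M - N)` and expanding gives a sum of tensor products of positive operators,
one of which is `tensor N`. Positivity of `N` is essential, and is the reason for requiring positive
dual solutions. -/
theorem tensor_sub_posSemidef {A : Type} [Fintype A] {n : ℕ} {M N : Fin n → Matrix A A ℂ}
    (hN : ∀ j, (N j).PosSemidef) (h : ∀ j, (M j - N j).PosSemidef) :
    (tensor M - tensor N).PosSemidef := by
  have h1 : tensor M = ∑ w : Fin n → Fin 2, tensor fun j => (![N j, M j - N j]) (w j) := by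
    rw [← tensor_sum]
    simp [Fin.sum_univ_two]
  have h2 : tensor N = tensor fun j => (![N j, M j - N j]) ((0 : Fin n → Fin 2) j) := by simp
  rw [h1, h2, ← Finset.add_sum_erase _ _ (Finset.mem_univ 0), add_sub_cancel_left]
  refine Matrix.posSemidef_sum _ fun w _ => tensor_posSemidef fun j => ?_
  rcases Fin.exists_fin_two.mp ⟨w j, rfl⟩ with h' | h' <;> rw [h'] <;> simp [hN, h]

theorem tensorPow_comp {A B C : Type} [Fintype A] [DecidableEq A] [Fintype B] [DecidableEq B]
    (n : ℕ) (Φ : Matrix A A ℂ →ₗ[ℂ] Matrix B B ℂ) (Θ : Matrix B B ℂ →ₗ[ℂ] Matrix C C ℂ) :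
    tensorPow n (Θ ∘ₗ Φ) = tensorPow n Θ ∘ₗ tensorPow n Φ :=
  tensor_linearMap_ext fun M => by
    simp only [LinearMap.comp_apply, tensorPow_tensor]

/-- `R j` is the Heisenberg-picture image of `D j` under `Φ`; adjointness is checked on product
operators. -/
theorem trace_tensor_mul_tensorPow {A B : Type} [Fintype A] [DecidableEq A] [Fintype B] {n : ℕ}
    {Φ : Matrix A A ℂ →ₗ[ℂ] Matrix B B ℂ} {D : Fin n → Matrix B B ℂ} {R : Fin n → Matrix A A ℂ}
    (h : ∀ j M, (R j * M).trace = (D j * Φ M).trace) (M : Matrix (Fin n → A) (Fin n → A) ℂ) :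
    (tensor R * M).trace = (tensor D * tensorPow n Φ M).trace := by
  let f : Matrix (Fin n → A) (Fin n → A) ℂ →ₗ[ℂ] ℂ :=
    Matrix.traceLinearMap _ ℂ ℂ ∘ₗ LinearMap.mulLeft ℂ (tensor R)
  let g : Matrix (Fin n → A) (Fin n → A) ℂ →ₗ[ℂ] ℂ :=
    Matrix.traceLinearMap _ ℂ ℂ ∘ₗ LinearMap.mulLeft ℂ (tensor D) ∘ₗ tensorPow n Φ
  have : f = g := tensor_linearMap_ext fun M => by
    simp [f, g, tensorPow_tensor, tensor_mul, tensor_trace, h]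
  exact LinearMap.congr_fun this M

/-! ### Feasible families of reduced states -/

/-- The partial trace over the first tensor factor. -/
def traceFst {A B : Type} [Fintype A] (M : Matrix (A × B) (A × B) ℂ) : Matrix B B ℂ :=
  Matrix.of fun b b' => ∑ a, M (a, b) (a, b')

theorem trace_one_kronecker_mul {A B : Type} [Fintype A] [Fintype B] [DecidableEq A]
    (H : Matrix B B ℂ) (M : Matrix (A × B) (A × B) ℂ) :
    (((1 : Matrix A A ℂ) ⊗ₖ H) * M).trace = (H * traceFst M).trace := by
  simp only [Matrix.trace, Matrix.diag_apply, Matrix.mul_apply, Fintype.sum_prod_type, traceFst,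
    Matrix.kroneckerMap_apply, Matrix.one_apply, Matrix.of_apply, ite_mul, one_mul, zero_mul,
    Finset.mul_sum]
  rw [Finset.sum_comm]
  refine Finset.sum_congr rfl fun b _ => ?_
  simpa using Finset.sum_comm

theorem traceFst_trace {A B : Type} [Fintype A] [Fintype B] (M : Matrix (A × B) (A × B) ℂ) :
    (traceFst M).trace = M.trace := by
  simp only [Matrix.trace, Matrix.diag_apply, traceFst, Matrix.of_apply, Fintype.sum_prod_type]
  exact Finset.sum_comm

theorem map_partialTrace {A B W : Type} [Fintype W] (Φ : Matrix A A ℂ →ₗ[ℂ] Matrix B B ℂ)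
    (M : Matrix (A × W) (A × W) ℂ) : Φ (partialTrace M) = partialTrace (ampl Φ W M) := by
  have : partialTrace M = ∑ w, Matrix.of fun a a' => M (a, w) (a', w) := by
    ext a a'
    simp [partialTrace, Matrix.sum_apply]
  rw [this, map_sum]
  ext b b'
  simp [partialTrace, Matrix.sum_apply, ampl]

theorem traceFst_partialTrace_swapLast {A B C : Type} [Fintype A] [Fintype C]
    (M : Matrix ((A × C) × B) ((A × C) × B) ℂ) :
    traceFst (partialTrace (swapLast M)) = traceFst M := by
  ext z z'
  simp [traceFst, partialTrace, swapLast, Fintype.sum_prod_type]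

theorem traceFst_ampl {A B W : Type} [Fintype A] [Fintype B] (Φ : Channel A B)
    (M : Matrix (A × W) (A × W) ℂ) : traceFst (ampl Φ.map W M) = traceFst M := by
  ext z z'
  exact Φ.tracePreserving (Matrix.of fun a a' => M (a, z) (a', z'))

theorem traceFst_swapLast {A B C : Type} [Fintype A] [Fintype C]
    (M : Matrix ((A × B) × C) ((A × B) × C) ℂ) :
    traceFst (swapLast M) = traceFst (partialTrace M) :=
  -- `swapLast` is an involution by definition.
  (traceFst_partialTrace_swapLast (swapLast M)).symm

namespace Strategy

variable {V : Interaction} (B : Strategy V)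

theorem state_zero : B.state 0 = swapLast (ampl B.first.map (V.Z 0) V.ρ) := rfl

theorem state_succ (i : Fin V.m) : B.state i.succ =
    swapLast (ampl (B.next i).map (V.Z i.succ)
      (swapLast (ampl (V.Ψ i).map (B.W i.castSucc) (B.state i.castSucc)))) := rfl

end Strategy

/-- The constraints that are satisfied by the reduced states of Bob's messages and Alice's memory,
for all strategies of Bob. -/
structure IsFeasible (V : Interaction)
    (r : ∀ i, Matrix (V.Y i × V.Z i) (V.Y i × V.Z i) ℂ) : Prop where
  posSemidef : ∀ i, (r i).PosSemidef
  zero : traceFst (r 0) = traceFst V.ρ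
  succ : ∀ i : Fin V.m, traceFst (r i.succ) = traceFst ((V.Ψ i).map (r i.castSucc))

/-- Bob's channels do not touch Alice's memory and preserve the trace, so they disappear when his
message and memory are traced out. -/
theorem Strategy.isFeasible {V : Interaction} (B : Strategy V) :
    IsFeasible V fun i => partialTrace (B.state i) where
  posSemidef i := (isDensity_partialTrace (B.state_isDensity i)).1
  zero := by rw [B.state_zero, traceFst_partialTrace_swapLast, traceFst_ampl]
  succ i := by
    rw [B.state_succ, traceFst_partialTrace_swapLast, traceFst_ampl, traceFst_swapLast,
      map_partialTrace]

/-! ### Weak duality for tensor powers -/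

/-- A solution of value at most `c` of the semidefinite program that is dual to the maximisation of
the expectation of the payoff operator `Q` over all feasible families. -/
structure IsDualFeasible (V : Interaction)
    (Q : Matrix (V.Y (Fin.last V.m) × V.Z (Fin.last V.m)) (V.Y (Fin.last V.m) × V.Z (Fin.last V.m)) ℂ)
    (c : ℝ) (H : ∀ i, Matrix (V.Z i) (V.Z i) ℂ) : Prop where
  posSemidef : ∀ i, (H i).PosSemidef
  last : ((1 : Matrix (V.Y _) (V.Y _) ℂ) ⊗ₖ H (Fin.last V.m) - Q).PosSemidef
  step : ∀ i : Fin V.m, ∃ R, R.PosSemidef ∧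
    ((1 : Matrix (V.Y _) (V.Y _) ℂ) ⊗ₖ H i.castSucc - R).PosSemidef ∧
    ∀ M, (R * M).trace = (((1 : Matrix (V.X _) (V.X _) ℂ) ⊗ₖ H i.succ) * (V.Ψ i).map M).trace
  value : (((1 : Matrix (V.X 0) (V.X 0) ℂ) ⊗ₖ H 0) * V.ρ).trace.re ≤ c

theorem trace_submatrix_mul_submatrix {A B : Type} [Fintype A] [Fintype B] (e : A ≃ B)
    (M N : Matrix B B ℂ) : (M.submatrix e e * N.submatrix e e).trace = (M * N).trace := by
  rw [Matrix.submatrix_mul_equiv]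
  exact Equiv.sum_comp e fun i => (M * N) i i

theorem tensor_one_kronecker {A B : Type} [DecidableEq A] (n : ℕ) (H : Matrix B B ℂ) :
    (tensor fun _ : Fin n => (1 : Matrix A A ℂ) ⊗ₖ H) =
      ((1 : Matrix (Fin n → A) (Fin n → A) ℂ) ⊗ₖ tensor fun _ : Fin n => H).submatrix
        (split n A B) (split n A B) := by
  ext p q
  simp only [tensor, Matrix.of_apply, Matrix.kroneckerMap_apply, Matrix.submatrix_apply,
    Finset.prod_mul_distrib]
  congr 1
  simp only [Matrix.one_apply, Finset.prod_ite_zero]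
  simp [funext_iff]

theorem trace_tensor_one_kronecker_mul {A B : Type} [Fintype A] [Fintype B] [DecidableEq A] {n : ℕ}
    (H : Matrix B B ℂ) (M : Matrix ((Fin n → A) × (Fin n → B)) ((Fin n → A) × (Fin n → B)) ℂ) :
    ((tensor fun _ : Fin n => (1 : Matrix A A ℂ) ⊗ₖ H) *
      M.submatrix (split n A B) (split n A B)).trace =
      ((tensor fun _ : Fin n => H) * traceFst M).trace := by
  rw [tensor_one_kronecker, trace_submatrix_mul_submatrix, trace_one_kronecker_mul]

/-- Weak duality, for the `n`-th tensor power of a dual solution. -/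
theorem IsDualFeasible.re_trace_tensor_mul_le {V : Interaction}
    {Q : Matrix (V.Y (Fin.last V.m) × V.Z (Fin.last V.m)) (V.Y (Fin.last V.m) × V.Z (Fin.last V.m)) ℂ}
    {c : ℝ} {H : ∀ i, Matrix (V.Z i) (V.Z i) ℂ} (hH : IsDualFeasible V Q c H) (hQ : Q.PosSemidef)
    {n k : ℕ} {r : ∀ i, Matrix ((Fin n → V.Y i) × (Fin n → V.Z i))
      ((Fin n → V.Y i) × (Fin n → V.Z i)) ℂ} (hr : IsFeasible (V.repeatThreshold n k) r) :
    ((tensor fun _ : Fin n => Q) *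
      (r (Fin.last V.m)).submatrix (split n _ _) (split n _ _)).trace.re ≤ c ^ n := by
  -- The dual potentials decrease along the interaction: the expectation of `(1 ⊗ H i)^{⊗n}` after
  -- message `i` is at most the one before it, and the initial one factorises.
  have h0 : ∀ i : Fin (V.m + 1), ((tensor fun _ : Fin n => (1 : Matrix (V.Y i) (V.Y i) ℂ) ⊗ₖ H i) *
      (r i).submatrix (split n _ _) (split n _ _)).trace.re ≤ c ^ n := by
    intro i
    induction i using Fin.induction with
    | zero =>
      have hz : traceFst (r 0) = traceFst ((tensor fun _ : Fin n => V.ρ).submatrix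
        (split n _ _).symm (split n _ _).symm) := hr.zero
      rw [trace_tensor_one_kronecker_mul, hz, ← trace_tensor_one_kronecker_mul (A := V.X 0),
        Matrix.submatrix_submatrix, Equiv.symm_comp_self, Matrix.submatrix_id_id, tensor_mul,
        tensor_trace, Finset.prod_const, Finset.card_univ,
        Fintype.card_fin]
      have h1 := trace_mul_nonneg (Matrix.PosSemidef.kronecker
        (Matrix.PosSemidef.one (n := V.X 0) (R := ℂ)) (hH.posSemidef 0)) V.ρ_density.1
      have h2 := hH.value
      rw [Complex.nonneg_iff] at h1
      generalize (((1 : Matrix (V.X 0) (V.X 0) ℂ) ⊗ₖ H 0) * V.ρ).trace = z at h1 h2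
      obtain ⟨h1, h3⟩ := h1
      -- The real part commutes with the power only because the trace is real.
      rw [show z = (z.re : ℂ) from Complex.ext rfl h3.symm, ← Complex.ofReal_pow, Complex.ofReal_re]
      exact pow_le_pow_left₀ h1 h2 n
    | succ i ih =>
      -- `R` is `1 ⊗ H i.succ` pulled back through Alice's channel; `hle` compares it with `1 ⊗ H
      -- i.castSucc`, and both facts tensorise.
      obtain ⟨R, hR, hle, hadj⟩ := hH.step i
      have hs : traceFst (r i.succ) = traceFst ((tensorPow n (V.Ψ i).map
        ((r i.castSucc).submatrix (split n _ _) (split n _ _))).submatrix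
        (split n _ _).symm (split n _ _).symm) := hr.succ i
      rw [trace_tensor_one_kronecker_mul, hs,
        ← trace_tensor_one_kronecker_mul (A := V.X i.succ), Matrix.submatrix_submatrix,
        Equiv.symm_comp_self, Matrix.submatrix_id_id, ← trace_tensor_mul_tensorPow fun _ => hadj]
      exact (re_trace_mul_le (tensor_sub_posSemidef (fun _ => hR) fun _ => hle)
        ((hr.posSemidef i.castSucc).submatrix _)).trans ih
  exact (re_trace_mul_le (tensor_sub_posSemidef (fun _ => hQ) fun _ => hH.last)
    ((hr.posSemidef (Fin.last V.m)).submatrix _)).trans (h0 _)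

/-! ### Exponential moments of the number of wins -/

theorem prod_outcomes {R : Type*} [CommSemiring R] {n : ℕ} (x : R) (w : Fin n → Fin 2) :
    ∏ j, (![1, x] (w j)) = x ^ (Finset.univ.filter fun j => w j = 1).card := by
  have h : ∀ j, ![1, x] (w j) = if w j = 1 then x else 1 := fun j => by
    rcases Fin.exists_fin_two.mp ⟨w j, rfl⟩ with h' | h' <;> simp [h']
  simp only [h, Finset.prod_ite, Finset.prod_const, one_pow, mul_one]

/-- The operator whose expectation is the moment generating function of the number of wins, as an
expansion over the outcome strings. -/
theorem tensor_add_smul {A : Type} (P : Fin 2 → Matrix A A ℂ) (n : ℕ) (x : ℂ) :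
    (tensor fun _ : Fin n => P 0 + x • P 1) = ∑ w : Fin n → Fin 2,
      x ^ (Finset.univ.filter fun j => w j = 1).card • tensor fun j => P (w j) := by
  have h : P 0 + x • P 1 = ∑ o, (![1, x] o) • P o := by simp [Fin.sum_univ_two]
  rw [h, tensor_sum]
  refine Finset.sum_congr rfl fun w _ => ?_
  rw [tensor_smul fun j => ![1, x] (w j), prod_outcomes]

/-- Markov's inequality as an operator inequality: for each outcome string, `x ^ wins` dominates `x
^ k` times the indicator of `k ≤ wins`, and the string's operator is positive. -/
theorem tensor_sub_thresholdPOVM_posSemidef {A : Type} [Fintype A] {P : Fin 2 → Matrix A A ℂ}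
    (hP : ∀ o, (P o).PosSemidef) (n k : ℕ) {x : ℝ} (hx : 1 ≤ x) :
    ((tensor fun _ : Fin n => P 0 + (x : ℂ) • P 1) -
      ((x ^ k : ℝ) : ℂ) • thresholdPOVM P n k 1).PosSemidef := by
  rw [tensor_add_smul, thresholdPOVM, Finset.smul_sum, Finset.sum_filter, ← Finset.sum_sub_distrib]
  refine Matrix.posSemidef_sum _ fun w _ => ?_
  have hT : (tensor fun j => P (w j)).PosSemidef := tensor_posSemidef fun j => hP _
  simp only [true_iff]
  split_ifs with h
  · rw [← sub_smul]
    refine hT.smul ?_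
    rw [← Complex.ofReal_pow, ← Complex.ofReal_sub, Complex.zero_le_real]
    exact sub_nonneg.mpr (pow_le_pow_right₀ hx h)
  · rw [sub_zero]
    refine hT.smul ?_
    rw [← Complex.ofReal_pow, Complex.zero_le_real]
    positivity

/-- A dual solution bounds the probability to win at least `k` of `n` parallel instances. -/
theorem IsDualFeasible.winProb_le {V : Interaction} {x c : ℝ} (hx : 1 ≤ x)
    {H : ∀ i, Matrix (V.Z i) (V.Z i) ℂ} (hH : IsDualFeasible V (V.P 0 + (x : ℂ) • V.P 1) c H)
    {n k : ℕ} (B : Strategy (V.repeatThreshold n k)) : x ^ k * B.winProb ≤ c ^ n := by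
  have hQ : (V.P 0 + (x : ℂ) • V.P 1).PosSemidef :=
    (V.P_povm.1 0).add ((V.P_povm.1 1).smul (Complex.zero_le_real.mpr (by linarith)))
  refine le_trans ?_ (hH.re_trace_tensor_mul_le hQ B.isFeasible)
  have h := re_trace_mul_le (tensor_sub_thresholdPOVM_posSemidef V.P_povm.1 n k hx)
    ((B.isFeasible.posSemidef (Fin.last V.m)).submatrix (split n _ _))
  refine le_trans (le_of_eq ?_) h
  rw [Matrix.smul_mul, Matrix.trace_smul, smul_eq_mul, Complex.re_ofReal_mul]
  congr 1
  exact congrArg Complex.re (trace_submatrix_mul_submatrix (split n (V.Y (Fin.last V.m)) (V.Z (Fin.last V.m)))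
    ((V.repeatThreshold n k).P 1) _).symm

/-! ### Strong duality -/

/-- Real linear functionals on Hermitian matrices are given by Hermitian matrices. -/
theorem exists_isHermitian_re_trace_mul {A : Type} [Fintype A]
    (g : Matrix A A ℂ →ₗ[ℝ] ℝ) : ∃ H : Matrix A A ℂ, H.IsHermitian ∧
      ∀ N : Matrix A A ℂ, N.IsHermitian → g N = (H * N).trace.re := by
  classical
  -- The real and imaginary matrix units determine `g`; the indices are swapped because the pairing
  -- is `trace (G * N)`.
  let G : Matrix A A ℂ := Matrix.of fun a' a =>
    (g (Matrix.single a a' 1) : ℂ) - g (Matrix.single a a' Complex.I) * Complex.I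
  have hG : ∀ N, g N = (G * N).trace.re := by
    intro N
    have h : ∀ a a', g (Matrix.single a a' (N a a')) = (G a' a * N a a').re := by
      intro a a'
      have : Matrix.single a a' (N a a') = (N a a').re • Matrix.single a a' (1 : ℂ) +
          (N a a').im • Matrix.single a a' Complex.I := by
        rw [Matrix.smul_single, Matrix.smul_single, ← Matrix.single_add]
        congr 1
        apply Complex.ext <;> simp
      rw [this, map_add, map_smul, map_smul]
      simp [G]
      ring
    conv_lhs => rw [Matrix.matrix_eq_sum_single N]
    simp only [map_sum, h, Matrix.trace, Matrix.diag_apply, Matrix.mul_apply, Complex.re_sum]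
    exact Finset.sum_comm
  -- Against Hermitian `N`, `Gᴴ` has the same real trace pairing as `G`, so the Hermitian part of
  -- `G` represents `g`.
  refine ⟨(1 / 2 : ℝ) • (G + Gᴴ), ?_, fun N hN => ?_⟩
  · rw [Matrix.IsHermitian, Matrix.conjTranspose_smul, Matrix.conjTranspose_add,
      Matrix.conjTranspose_conjTranspose, add_comm, star_trivial]
  · have h : (Gᴴ * N).trace.re = (G * N).trace.re := by
      have : (Gᴴ * N).trace = star (G * N).trace := by
        rw [← Matrix.trace_conjTranspose, Matrix.conjTranspose_mul, hN.eq, Matrix.trace_mul_comm]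
      rw [this]
      simp
    rw [Matrix.smul_mul, Matrix.trace_smul, Matrix.add_mul, Matrix.trace_add, Complex.smul_re,
      Complex.add_re, h, hG]
    simp
    ring

theorem traceFst_isHermitian {A B : Type} [Fintype A] {M : Matrix (A × B) (A × B) ℂ}
    (h : M.IsHermitian) : (traceFst M).IsHermitian := by
  ext b b'
  simp only [traceFst, Matrix.conjTranspose_apply, Matrix.of_apply, star_sum]
  exact Finset.sum_congr rfl fun a _ => h.apply _ _

theorem posSemidef_of_one_kronecker {A B : Type} [DecidableEq A] [Nonempty A]
    {H : Matrix B B ℂ} (h : ((1 : Matrix A A ℂ) ⊗ₖ H).PosSemidef) : H.PosSemidef := by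
  have a : A := Classical.arbitrary A
  convert h.submatrix fun b => (a, b)
  ext b b'
  simp

/-- The reduced states and the payoff of a family of operators, as a linear map. -/
def constraintMap (V : Interaction)
    (Q : Matrix (V.Y (Fin.last V.m) × V.Z (Fin.last V.m)) (V.Y (Fin.last V.m) × V.Z (Fin.last V.m)) ℂ) :
    (∀ i, Matrix (V.Y i × V.Z i) (V.Y i × V.Z i) ℂ) →ₗ[ℝ]
      (∀ i, Matrix (V.Z i) (V.Z i) ℂ) × ℝ where
  toFun r := (Fin.cases (traceFst (r 0)) fun i =>
    traceFst (r i.succ) - traceFst ((V.Ψ i).map (r i.castSucc)), (Q * r (Fin.last V.m)).trace.re)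
  map_add' r r' := by
    refine Prod.ext (funext fun i => ?_) (by simp [Matrix.mul_add])
    induction i using Fin.cases <;> ext <;>
      simp [traceFst, Finset.sum_add_distrib]
    ring
  map_smul' c r := by
    refine Prod.ext (funext fun i => ?_) (by simp)
    induction i using Fin.cases <;> ext <;>
      simp [traceFst, Finset.smul_sum, smul_sub]

/-- A linear image of a closed cone need not be closed. Here the constraint values bound all the
traces of a positive family, so that near any point the image comes from a compact set of square
roots. -/
theorem isClosed_image_constraintMap (V : Interaction)
    (Q : Matrix (V.Y (Fin.last V.m) × V.Z (Fin.last V.m)) (V.Y (Fin.last V.m) × V.Z (Fin.last V.m)) ℂ) :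
    IsClosed (constraintMap V Q '' {r | ∀ i, (r i).PosSemidef}) := by
  refine isClosed_of_closure_subset fun y hy => ?_
  let sq : (∀ i, Matrix (V.Y i × V.Z i) (V.Y i × V.Z i) ℂ) →
    (∀ i, Matrix (V.Y i × V.Z i) (V.Y i × V.Z i) ℂ) := fun S i => (S i)ᴴ * S i
  obtain ⟨R, hR0, hR⟩ : ∃ R : ℝ, 0 ≤ R ∧ ∀ i, (y.1 i).trace.re < R := by
    obtain ⟨R, hR⟩ := (Set.finite_range fun i => (y.1 i).trace.re).bddAbove
    exact ⟨max R 0 + 1, by positivity, fun i => lt_of_le_of_lt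
      ((hR (Set.mem_range_self i)).trans (le_max_left R 0)) (lt_add_one _)⟩
  let N : Set ((∀ i, Matrix (V.Z i) (V.Z i) ℂ) × ℝ) := {y | ∀ i, (y.1 i).trace.re < R}
  have hN : IsOpen N := by
    simp only [N, Set.ofPred_forall]
    refine isOpen_iInter_of_finite fun i => isOpen_lt ?_ continuous_const
    exact Complex.continuous_re.comp
      (Continuous.matrix_trace ((continuous_apply i).comp continuous_fst))
  let K : Set (∀ i, Matrix (V.Y i × V.Z i) (V.Y i × V.Z i) ℂ) :=
    Set.univ.pi fun i => Set.univ.pi fun _ => Set.univ.pi fun _ =>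
      Metric.closedBall (0 : ℂ) (Real.sqrt ((V.m + 1) * R))
  have hK : IsCompact K := isCompact_univ_pi fun i => isCompact_univ_pi fun _ =>
    isCompact_univ_pi fun _ => isCompact_closedBall _ _
  have hcont : Continuous fun S => constraintMap V Q (sq S) := by
    refine (LinearMap.continuous_of_finiteDimensional (constraintMap V Q)).comp ?_
    exact continuous_pi fun i => ((continuous_apply i).matrix_conjTranspose).matrix_mul
      (continuous_apply i)
  have hsub : N ∩ constraintMap V Q '' {r | ∀ i, (r i).PosSemidef} ⊆
      (fun S => constraintMap V Q (sq S)) '' K := by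
    rintro _ ⟨hN, r, hr, rfl⟩
    choose S hS using fun i => exists_eq_conjTranspose_mul_self (hr i)
    -- Since Alice's channels preserve the trace, the constraint values bound the increments of
    -- `trace (r i)`, each by `R`.
    have htr : ∀ i : Fin (V.m + 1), (r i).trace.re ≤ (i + 1) * R := by
      intro i
      induction i using Fin.induction with
      | zero =>
        have := hN 0
        simp only [constraintMap, LinearMap.coe_mk, AddHom.coe_mk, Fin.cases_zero,
          traceFst_trace] at this
        simpa using this.le
      | succ i ih =>
        have := hN i.succ
        simp only [constraintMap, LinearMap.coe_mk, AddHom.coe_mk, Fin.cases_succ,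
          Matrix.trace_sub, traceFst_trace, (V.Ψ i).tracePreserving, Complex.sub_re] at this
        simp only [Fin.val_succ, Fin.val_castSucc] at ih ⊢
        push_cast
        linarith
    refine ⟨S, ?_, congrArg _ (funext fun i => (hS i).symm)⟩
    intro i _ p _ q _
    rw [mem_closedBall_zero_iff]
    refine Real.le_sqrt_of_sq_le ?_
    have h1 : (r i).trace.re = ∑ q, ∑ p, ‖S i p q‖ ^ 2 := by
      rw [hS i]
      simp only [Matrix.trace, Matrix.diag_apply, Matrix.mul_apply, Matrix.conjTranspose_apply,
        Complex.re_sum]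
      refine Finset.sum_congr rfl fun q _ => Finset.sum_congr rfl fun p _ => ?_
      rw [← Complex.normSq_eq_norm_sq, RCLike.star_def, ← Complex.normSq_eq_conj_mul_self,
        Complex.ofReal_re]
    have h2 : ‖S i p q‖ ^ 2 ≤ (r i).trace.re := by
      rw [h1]
      exact (Finset.single_le_sum (f := fun p => ‖S i p q‖ ^ 2) (fun _ _ => by positivity)
        (Finset.mem_univ p)).trans (Finset.single_le_sum (f := fun q => ∑ p, ‖S i p q‖ ^ 2)
        (fun _ _ => by positivity) (Finset.mem_univ q))
    refine h2.trans ((htr i).trans (mul_le_mul_of_nonneg_right ?_ hR0))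
    have : (i : ℕ) ≤ V.m := Nat.lt_succ_iff.mp i.2
    gcongr
  have hy' : y ∈ (fun S => constraintMap V Q (sq S)) '' K := by
    rw [← (hK.image hcont).isClosed.closure_eq]
    exact closure_mono hsub (hN.inter_closure ⟨hR, hy⟩)
  obtain ⟨S, -, rfl⟩ := hy'
  exact ⟨sq S, fun i => Matrix.posSemidef_conjTranspose_mul_self _, rfl⟩

/-- The separating functionals: strong duality before the representation of functionals by
matrices. -/
theorem exists_dual_functional {V : Interaction}
    {Q : Matrix (V.Y (Fin.last V.m) × V.Z (Fin.last V.m)) (V.Y (Fin.last V.m) × V.Z (Fin.last V.m)) ℂ}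
    {v v' : ℝ} (h : ∀ r, IsFeasible V r → (Q * r (Fin.last V.m)).trace.re ≤ v) (hv : v < v') :
    ∃ g : ∀ i, Matrix (V.Z i) (V.Z i) ℂ →ₗ[ℝ] ℝ,
      (∀ M, M.PosSemidef → (Q * M).trace.re ≤ g (Fin.last V.m) (traceFst M)) ∧
      (∀ (i : Fin V.m) M, M.PosSemidef →
        g i.succ (traceFst ((V.Ψ i).map M)) ≤ g i.castSucc (traceFst M)) ∧
      g 0 (traceFst V.ρ) ≤ v' := by
  have : ∀ i, LocallyConvexSpace ℝ (Matrix (V.Z i) (V.Z i) ℂ) := fun i =>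
    inferInstanceAs (LocallyConvexSpace ℝ (V.Z i → V.Z i → ℂ))
  set L := constraintMap V Q with hL
  let w : ∀ i, Matrix (V.Z i) (V.Z i) ℂ := Fin.cases (traceFst V.ρ) fun _ => 0
  have hfeas : ∀ r, (∀ i, (r i).PosSemidef) → (L r).1 = w → IsFeasible V r := by
    intro r hr hw
    refine ⟨hr, congrFun hw 0, fun i => ?_⟩
    exact sub_eq_zero.mp (congrFun hw i.succ)
  -- `w` is the constraint value of the feasible families, none of which has payoff as large as
  -- `v'`.
  have hnot : (w, v') ∉ L '' {r | ∀ i, (r i).PosSemidef} := by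
    rintro ⟨r, hr, he⟩
    have h1 := h r (hfeas r hr (congrArg Prod.fst he))
    have h2 : (Q * r (Fin.last V.m)).trace.re = v' := congrArg Prod.snd he
    linarith
  have hconv : Convex ℝ (L '' {r | ∀ i, (r i).PosSemidef}) := by
    refine Convex.linear_image ?_ L
    intro r hr r' hr' a b ha hb _ i
    have ha' : (0 : ℂ) ≤ a := Complex.zero_le_real.mpr ha
    have hb' : (0 : ℂ) ≤ b := Complex.zero_le_real.mpr hb
    exact ((hr i).smul ha').add ((hr' i).smul hb')
  obtain ⟨f, u, hfu, huf⟩ := geometric_hahn_banach_point_closed hconv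
    (isClosed_image_constraintMap V Q) hnot
  have hu : u < 0 := by
    simpa using huf _ ⟨0, fun i => Matrix.PosSemidef.zero, map_zero L⟩
  -- The image is a cone: a negative value of `f` could be rescaled to equal `u`, against the strict
  -- separation.
  have hpos : ∀ r, (∀ i, (r i).PosSemidef) → 0 ≤ f (L r) := by
    intro r hr
    by_contra! hneg
    have h1 := huf (L ((u / f (L r)) • r)) ⟨_, fun i => (hr i).smul
      (Complex.zero_le_real.mpr (div_nonneg_of_nonpos hu.le hneg.le)), rfl⟩
    rw [map_smul, map_smul, smul_eq_mul, div_mul_cancel₀ _ hneg.ne] at h1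
    exact lt_irrefl _ h1
  set μ : ℝ := - f (0, 1) with hμ
  let g : ∀ i, Matrix (V.Z i) (V.Z i) ℂ →ₗ[ℝ] ℝ := fun i =>
    (f : _ →ₗ[ℝ] ℝ) ∘ₗ LinearMap.inl ℝ (∀ i, Matrix (V.Z i) (V.Z i) ℂ) ℝ ∘ₗ
      LinearMap.single ℝ (fun i => Matrix (V.Z i) (V.Z i) ℂ) i
  have hf : ∀ y, f y = ∑ i, g i (y.1 i) - μ * y.2 := by
    intro y
    have h1 : y = (∑ i, Pi.single i (y.1 i), 0) + y.2 • ((0, 1) :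
        (∀ i, Matrix (V.Z i) (V.Z i) ℂ) × ℝ) := by
      rw [Finset.univ_sum_single]
      ext <;> simp
    have h2 : f (∑ i, Pi.single i (y.1 i), 0) = ∑ i, g i (y.1 i) := by
      have : ((∑ i, Pi.single i (y.1 i), 0) : (∀ i, Matrix (V.Z i) (V.Z i) ℂ) × ℝ) =
        ∑ i, (Pi.single i (y.1 i), 0) := by
        refine Prod.ext ?_ ?_
        · rw [Prod.fst_sum]
        · rw [Prod.snd_sum]; simp
      rw [this, map_sum]
      rfl
    conv_lhs => rw [h1]
    rw [map_add, map_smul, h2, hμ, smul_eq_mul]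
    ring
  have hfL : ∀ r, f (L r) = ∑ i, g i (traceFst (r i)) -
      ∑ i : Fin V.m, g i.succ (traceFst ((V.Ψ i).map (r i.castSucc))) -
        μ * (Q * r (Fin.last V.m)).trace.re := by
    intro r
    rw [hf, Fin.sum_univ_succ, Fin.sum_univ_succ (f := fun i => g i (traceFst (r i)))]
    simp only [hL, constraintMap, LinearMap.coe_mk, AddHom.coe_mk, Fin.cases_zero, Fin.cases_succ,
      map_sub, Finset.sum_sub_distrib]
    ring
  -- The separating hyperplane is not vertical, because a strategy exists: its point lies above `w`
  -- with payoff at most `v < v'`, and there `f` is nonnegative, while `f (w, v') < 0`.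
  have hμpos : 0 < μ := by
    have B : Strategy V := Classical.arbitrary _
    have hB := B.isFeasible
    set r := fun i => partialTrace (B.state i)
    have h1 : L r = (w, (Q * r (Fin.last V.m)).trace.re) := by
      refine Prod.ext (funext fun i => ?_) rfl
      induction i using Fin.cases with
      | zero => exact hB.zero
      | succ i => exact sub_eq_zero.mpr (hB.succ i)
    have h2 := hpos r hB.posSemidef
    have h3 := h r hB
    have h4 : f (w, v') < 0 := hfu.trans hu
    rw [h1, hf] at h2
    rw [hf] at h4
    simp only at h2 h4
    nlinarith
  -- Families supported on a single message isolate one dual constraint each.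
  have hsingle : ∀ i (M : Matrix (V.Y i × V.Z i) (V.Y i × V.Z i) ℂ), M.PosSemidef →
      ∀ j, ((Pi.single i M : ∀ i, Matrix (V.Y i × V.Z i) (V.Y i × V.Z i) ℂ) j).PosSemidef := by
    intro i M hM j
    by_cases hij : j = i
    · subst hij; simpa
    · rw [Pi.single_eq_of_ne hij]; exact Matrix.PosSemidef.zero
  have htr0 : ∀ i, traceFst (0 : Matrix (V.Y i × V.Z i) (V.Y i × V.Z i) ℂ) = 0 := by
    intro i; ext; simp [traceFst]
  have htr0' : ∀ i, traceFst (0 : Matrix (V.X i × V.Z i) (V.X i × V.Z i) ℂ) = 0 := by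
    intro i; ext; simp [traceFst]
  have hsum : ∀ i (M : Matrix (V.Y i × V.Z i) (V.Y i × V.Z i) ℂ),
      ∑ j, g j (traceFst ((Pi.single i M : ∀ i, Matrix (V.Y i × V.Z i) (V.Y i × V.Z i) ℂ) j)) =
        g i (traceFst M) := by
    intro i M
    rw [Finset.sum_eq_single i (fun j _ hj => by rw [Pi.single_eq_of_ne hj, htr0, map_zero])
      (fun h => absurd (Finset.mem_univ i) h), Pi.single_eq_same]
  -- Normalisation makes the coefficient of the payoff equal to one.
  refine ⟨fun i => μ⁻¹ • g i, fun M hM => ?_, fun i M hM => ?_, ?_⟩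
  · have h1 := hpos _ (hsingle _ M hM)
    rw [hfL, hsum, Pi.single_eq_same, Finset.sum_eq_zero fun i _ => by
      rw [Pi.single_eq_of_ne (Fin.castSucc_lt_last i).ne, map_zero, htr0', map_zero]] at h1
    rw [LinearMap.smul_apply, smul_eq_mul, ← div_eq_inv_mul, le_div_iff₀ hμpos]
    linarith
  · have h1 := hpos _ (hsingle _ M hM)
    rw [hfL, hsum, Pi.single_eq_of_ne (Fin.castSucc_lt_last i).ne',
      Finset.sum_eq_single i (fun j _ hj => by
        rw [Pi.single_eq_of_ne ((Fin.castSucc_injective _).ne hj), map_zero, htr0', map_zero])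
      (fun h => absurd (Finset.mem_univ i) h), Pi.single_eq_same] at h1
    simp only [LinearMap.smul_apply, smul_eq_mul]
    refine mul_le_mul_of_nonneg_left ?_ (inv_nonneg.mpr hμpos.le)
    simpa using h1
  · have h1 : f (w, v') < 0 := hfu.trans hu
    rw [hf, Fin.sum_univ_succ] at h1
    simp only [w, Fin.cases_zero, Fin.cases_succ, map_zero, Finset.sum_const_zero, add_zero] at h1
    rw [LinearMap.smul_apply, smul_eq_mul, ← div_eq_inv_mul, div_le_iff₀ hμpos]
    linarith

/-- Strong duality, for a verifier who applies isometries. -/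
theorem exists_isDualFeasible {V : Interaction}
    (hV : ∀ i : Fin V.m, ∃ A : Matrix (V.X i.succ × V.Z i.succ) (V.Y i.castSucc × V.Z i.castSucc) ℂ,
      ∀ M, (V.Ψ i).map M = A * M * Aᴴ)
    {Q : Matrix (V.Y (Fin.last V.m) × V.Z (Fin.last V.m)) (V.Y (Fin.last V.m) × V.Z (Fin.last V.m)) ℂ}
    (hQ : Q.PosSemidef) {v v' : ℝ}
    (h : ∀ r, IsFeasible V r → (Q * r (Fin.last V.m)).trace.re ≤ v) (hv : v < v') :
    ∃ H, IsDualFeasible V Q v' H := by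
  obtain ⟨g, hg1, hg2, hg3⟩ := exists_dual_functional h hv
  choose A hA using hV
  choose H hH hgH using fun i => exists_isHermitian_re_trace_mul (g i)
  have hD : ∀ i, ((1 : Matrix (V.Y i) (V.Y i) ℂ) ⊗ₖ H i).IsHermitian := fun i => by
    rw [Matrix.IsHermitian, Matrix.conjTranspose_kronecker, (hH i).eq, Matrix.conjTranspose_one]
  have hD' : ∀ i, ((1 : Matrix (V.X i) (V.X i) ℂ) ⊗ₖ H i).IsHermitian := fun i => by
    rw [Matrix.IsHermitian, Matrix.conjTranspose_kronecker, (hH i).eq, Matrix.conjTranspose_one]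
  have hadj : ∀ i M, ((A i)ᴴ * ((1 : Matrix (V.X i.succ) (V.X i.succ) ℂ) ⊗ₖ H i.succ) * A i * M).trace =
      (((1 : Matrix (V.X i.succ) (V.X i.succ) ℂ) ⊗ₖ H i.succ) * (V.Ψ i).map M).trace := by
    intro i M
    rw [hA, Matrix.mul_assoc, Matrix.mul_assoc, Matrix.trace_mul_comm, Matrix.mul_assoc]
  have hlast : ((1 : Matrix (V.Y _) (V.Y _) ℂ) ⊗ₖ H (Fin.last V.m) - Q).PosSemidef := by
    refine posSemidef_of_re_trace_mul_nonneg ((hD _).sub hQ.1) fun M hM => ?_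
    rw [Matrix.sub_mul, Matrix.trace_sub, Complex.sub_re, trace_one_kronecker_mul,
      ← hgH _ _ (traceFst_isHermitian hM.1)]
    exact sub_nonneg.mpr (hg1 M hM)
  have hstep : ∀ i : Fin V.m, ((1 : Matrix (V.Y i.castSucc) (V.Y i.castSucc) ℂ) ⊗ₖ H i.castSucc -
      (A i)ᴴ * ((1 : Matrix (V.X i.succ) (V.X i.succ) ℂ) ⊗ₖ H i.succ) * A i).PosSemidef := by
    intro i
    refine posSemidef_of_re_trace_mul_nonneg ((hD _).sub
      (Matrix.isHermitian_conjTranspose_mul_mul _ (hD' _))) fun M hM => ?_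
    have hM' : ((V.Ψ i).map M).IsHermitian := by
      rw [hA]; exact Matrix.isHermitian_mul_mul_conjTranspose _ hM.1
    rw [Matrix.sub_mul, Matrix.trace_sub, Complex.sub_re, hadj, trace_one_kronecker_mul,
      trace_one_kronecker_mul, ← hgH _ _ (traceFst_isHermitian hM.1),
      ← hgH _ _ (traceFst_isHermitian hM')]
    exact sub_nonneg.mpr (hg2 i M hM)
  have hR : ∀ i : Fin V.m, (H i.succ).PosSemidef →
      ((A i)ᴴ * ((1 : Matrix (V.X i.succ) (V.X i.succ) ℂ) ⊗ₖ H i.succ) * A i).PosSemidef := fun i hi =>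
    (Matrix.PosSemidef.kronecker Matrix.PosSemidef.one hi).conjTranspose_mul_mul_same _
  -- Backward induction: `1 ⊗ H` dominates the positive `Q` at the end, and before that the pullback
  -- of the next, already positive, operator.
  have hpsd : ∀ i, (H i).PosSemidef := by
    intro i
    induction i using Fin.reverseInduction with
    | last =>
      have := hlast.add hQ
      rw [sub_add_cancel] at this
      exact posSemidef_of_one_kronecker this
    | cast i ih =>
      have := (hstep i).add (hR i ih)
      rw [sub_add_cancel] at this
      exact posSemidef_of_one_kronecker this
  refine ⟨H, hpsd, hlast, fun i => ⟨_, hR i (hpsd _), hstep i, hadj i⟩, ?_⟩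
  rw [trace_one_kronecker_mul, ← hgH _ _ (traceFst_isHermitian V.ρ_density.1.1)]
  exact hg3

/-! ### Channels from Kraus operators -/

theorem kronecker_one_mul_mul_apply {A B W : Type} [Fintype A] [Fintype W] [DecidableEq W]
    (K : Matrix B A ℂ) (M : Matrix (A × W) (A × W) ℂ) (p q : B × W) :
    ((K ⊗ₖ (1 : Matrix W W ℂ)) * M * (K ⊗ₖ (1 : Matrix W W ℂ))ᴴ) p q =
      (K * (Matrix.of fun a a' => M (a, p.2) (a', q.2)) * Kᴴ) p.1 q.1 := by
  simp [Matrix.mul_apply, Fintype.sum_prod_type, Matrix.one_apply, Finset.sum_mul,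
    apply_ite star]

/-- The linear map with given Kraus operators. -/
def krausMap {A B ι : Type} [Fintype A] [Fintype ι] (K : ι → Matrix B A ℂ) :
    Matrix A A ℂ →ₗ[ℂ] Matrix B B ℂ where
  toFun M := ∑ l, K l * M * (K l)ᴴ
  map_add' M N := by simp [Matrix.mul_add, Matrix.add_mul, Finset.sum_add_distrib]
  map_smul' c M := by simp [Finset.smul_sum]

theorem krausMap_apply {A B ι : Type} [Fintype A] [Fintype ι] (K : ι → Matrix B A ℂ)
    (M : Matrix A A ℂ) : krausMap K M = ∑ l, K l * M * (K l)ᴴ := rfl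

/-- The channel with given Kraus operators. -/
def Channel.ofKraus {A B ι : Type} [Fintype A] [DecidableEq A] [Fintype B] [Fintype ι]
    (K : ι → Matrix B A ℂ) (hK : ∑ l, (K l)ᴴ * K l = 1) : Channel A B where
  map := krausMap K
  completelyPositive W _ M hM := by
    classical
    have : ampl (krausMap K) W M =
        ∑ l, (K l ⊗ₖ (1 : Matrix W W ℂ)) * M * (K l ⊗ₖ (1 : Matrix W W ℂ))ᴴ := by
      ext p q
      simp only [Matrix.sum_apply, kronecker_one_mul_mul_apply]
      simp [ampl, krausMap_apply, Matrix.sum_apply]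
    rw [this]
    exact Matrix.posSemidef_sum _ fun l _ => hM.mul_mul_conjTranspose_same _
  tracePreserving M := by
    rw [krausMap_apply, Matrix.trace_sum]
    simp_rw [Matrix.mul_assoc, Matrix.trace_mul_comm (K _), Matrix.mul_assoc]
    rw [← Matrix.trace_sum, ← Matrix.mul_sum, hK, Matrix.mul_one]

theorem Channel.ofKraus_map {A B ι : Type} [Fintype A] [DecidableEq A] [Fintype B] [Fintype ι]
    (K : ι → Matrix B A ℂ) (hK : ∑ l, (K l)ᴴ * K l = 1) (M : Matrix A A ℂ) :
    (Channel.ofKraus K hK).map M = ∑ l, K l * M * (K l)ᴴ := rfl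

/-! ### Purifications with the same reduced state are related by a channel -/

/-- The pseudoinverse comes from the functional calculus of `x ↦ x⁻¹`, where `0⁻¹ = 0` gives the
right value on the kernel; continuity is free on a finite spectrum. -/
theorem exists_pseudoinverse {A : Type} [Fintype A] {G : Matrix A A ℂ} (hG : G.IsHermitian) :
    ∃ G' : Matrix A A ℂ, G'.IsHermitian ∧ G * G' * G = G ∧ G' * G * G' = G' := by
  classical
  have hG' : IsSelfAdjoint G := hG
  have hc : ∀ f : ℝ → ℝ, ContinuousOn f (spectrum ℝ G) := fun f =>
    (Matrix.finite_real_spectrum (A := G)).continuousOn f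
  have hid : cfc (fun x : ℝ => x) G = G := cfc_id' ℝ G
  refine ⟨cfc (fun x : ℝ => x⁻¹) G, cfc_predicate (R := ℝ) (p := IsSelfAdjoint) _ G, ?_, ?_⟩
  · calc G * cfc (fun x : ℝ => x⁻¹) G * G
        = cfc (fun x : ℝ => x) G * cfc (fun x : ℝ => x⁻¹) G * cfc (fun x : ℝ => x) G := by rw [hid]
      _ = cfc (fun x : ℝ => x) G := by
        rw [← cfc_mul _ _ G (hc _) (hc _), ← cfc_mul _ _ G (hc _) (hc _)]
        simp only [mul_inv_mul_cancel]
      _ = G := hid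
  · calc cfc (fun x : ℝ => x⁻¹) G * G * cfc (fun x : ℝ => x⁻¹) G
        = cfc (fun x : ℝ => x⁻¹) G * cfc (fun x : ℝ => x) G * cfc (fun x : ℝ => x⁻¹) G := by
          rw [hid]
      _ = cfc (fun x : ℝ => x⁻¹) G := by
        rw [← cfc_mul _ _ G (hc _) (hc _), ← cfc_mul _ _ G (hc _) (hc _)]
        congr 1
        ext x
        by_cases hx : x = 0 <;> simp [hx]

theorem mul_eq_self_of_conjTranspose_mul_self_mul {P Z : Type} [Fintype P] [Fintype Z]
    {S : Matrix P Z ℂ} {E : Matrix Z Z ℂ} (hE : Sᴴ * S * E = Sᴴ * S) : S * E = S := by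
  have h : (S * E - S)ᴴ * (S * E - S) = 0 := by
    have h1 : Sᴴ * (S * E - S) = 0 := by
      rw [Matrix.mul_sub, ← Matrix.mul_assoc, hE, sub_self]
    rw [Matrix.conjTranspose_sub, Matrix.conjTranspose_mul, Matrix.sub_mul, Matrix.mul_assoc, h1,
      Matrix.mul_zero, sub_zero]
  exact sub_eq_zero.mp (Matrix.conjTranspose_mul_self_eq_zero.mp h)

/-- Equal Gram matrices make the assignment of `S` to `T` a partial isometry, `K = S G Tᴴ` with `G`
the pseudoinverse of `Tᴴ T`. `N` projects onto the complement of the range of `T`; sending that part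
to a fixed basis state completes `K` to a channel, whatever the dimensions. -/
theorem exists_channel_of_conjTranspose_mul_self_eq {P R Z : Type} [Fintype P] [Fintype R]
    [Nonempty R] [Fintype Z] {T : Matrix P Z ℂ} {S : Matrix R Z ℂ} (h : Tᴴ * T = Sᴴ * S) :
    ∃ Φ : Channel P R, ∀ E : Matrix Z Z ℂ, Φ.map (T * E * Tᴴ) = S * E * Sᴴ := by
  classical
  obtain ⟨G, hG, h1, h2⟩ := exists_pseudoinverse (Matrix.isHermitian_conjTranspose_mul_self T)
  have hG1 : T * (G * (Tᴴ * T)) = T :=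
    mul_eq_self_of_conjTranspose_mul_self_mul (by rw [← Matrix.mul_assoc, h1])
  have hG2 : S * (G * (Tᴴ * T)) = S :=
    mul_eq_self_of_conjTranspose_mul_self_mul (by rw [← h, ← Matrix.mul_assoc, h1])
  let K : Matrix R P ℂ := S * G * Tᴴ
  let N : Matrix P P ℂ := 1 - T * G * Tᴴ
  have hKT : K * T = S := by
    simp only [K, Matrix.mul_assoc]
    exact hG2
  have hNT : N * T = 0 := by
    simp only [N, Matrix.sub_mul, Matrix.one_mul, Matrix.mul_assoc]
    rw [hG1, sub_self]
  have hNh : Nᴴ = N := by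
    simp [N, Matrix.conjTranspose_mul, hG.eq, Matrix.mul_assoc]
  have hNN : Nᴴ * N = N := by
    rw [hNh]
    nth_rewrite 2 [show N = 1 - T * (G * Tᴴ) by simp only [N, Matrix.mul_assoc]]
    rw [Matrix.mul_sub, Matrix.mul_one, ← Matrix.mul_assoc, hNT, Matrix.zero_mul, sub_zero]
  have hKK : Kᴴ * K = 1 - N := by
    have : Kᴴ * K = T * (G * (Sᴴ * S) * G) * Tᴴ := by
      simp only [K, Matrix.conjTranspose_mul, Matrix.conjTranspose_conjTranspose, hG.eq,
        Matrix.mul_assoc]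
    rw [this, ← h, h2]
    simp [N]
  let r : R := Classical.arbitrary R
  let L : Option P → Matrix R P ℂ := fun o => o.elim K fun p => Matrix.single r p (1 : ℂ) * N
  have hL : ∑ l, (L l)ᴴ * L l = 1 := by
    have h3 : ∀ p, (Matrix.single r p (1 : ℂ) * N)ᴴ * (Matrix.single r p (1 : ℂ) * N) =
        Nᴴ * (Matrix.single p p (1 : ℂ) * N) := by
      intro p
      rw [Matrix.conjTranspose_mul, Matrix.conjTranspose_single, star_one, Matrix.mul_assoc,
        ← Matrix.mul_assoc (Matrix.single p r (1 : ℂ)), Matrix.single_mul_single_same, one_mul]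
    rw [Fintype.sum_option]
    simp only [L, Option.elim, h3]
    rw [← Matrix.mul_sum, ← Matrix.sum_mul, Matrix.sum_single_one, Matrix.one_mul, hNN, hKK]
    simp
  refine ⟨Channel.ofKraus L hL, fun E => ?_⟩
  rw [Channel.ofKraus_map, Fintype.sum_option, Finset.sum_eq_zero, add_zero]
  · simp only [L, Option.elim]
    rw [show S * E * Sᴴ = K * T * E * (K * T)ᴴ by rw [hKT], Matrix.conjTranspose_mul K T]
    simp only [Matrix.mul_assoc]
  · intro p _
    simp only [L, Option.elim]
    rw [Matrix.mul_assoc T, ← Matrix.mul_assoc _ T, Matrix.mul_assoc _ N, hNT, Matrix.mul_zero,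
      Matrix.zero_mul, Matrix.zero_mul]

/-- Unitary equivalence of purifications, with a channel in place of the unitary: `T` and `S` are
vectors with the same reduced operator on `ℂ^Z`, and the conclusion gives the blocks of `Φ ⊗ id`. -/
theorem exists_channel_of_marginal_eq {P R Z : Type} [Fintype P] [Fintype R] [Nonempty R]
    [Fintype Z] {T : Matrix P Z ℂ} {S : Matrix R Z ℂ}
    (h : ∀ z z', ∑ p, T p z * star (T p z') = ∑ p, S p z * star (S p z')) :
    ∃ Φ : Channel P R, ∀ z z', Φ.map (Matrix.of fun p p' => T p z * star (T p' z')) =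
      Matrix.of fun p p' => S p z * star (S p' z') := by
  classical
  have h1 : Tᴴ * T = Sᴴ * S := by
    ext z z'
    simp only [Matrix.mul_apply, Matrix.conjTranspose_apply, mul_comm (star _)]
    -- `Tᴴ * T` is the transpose of the reduced operator.
    exact h z' z
  obtain ⟨Φ, hΦ⟩ := exists_channel_of_conjTranspose_mul_self_eq h1
  refine ⟨Φ, fun z z' => ?_⟩
  have h2 : ∀ {P : Type} (T : Matrix P Z ℂ), (Matrix.of fun p p' => T p z * star (T p' z')) =
      T * Matrix.single z z' (1 : ℂ) * Tᴴ := by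
    intro P T
    ext p p'
    simp [Matrix.mul_apply, Matrix.single_apply, ite_and]
  rw [h2, h2, hΦ]

/-! ### Realisation of feasible families -/

/-- The rank-one operator given by a vector of `ℂ^A ⊗ ℂ^W`, written as a matrix. -/
def pureState {A W : Type} (S : Matrix A W ℂ) : Matrix (A × W) (A × W) ℂ :=
  Matrix.of fun p q => S p.1 p.2 * star (S q.1 q.2)

theorem ampl_pureState {A B W : Type} [Fintype A] [Fintype B]
    {Φ : Matrix A A ℂ →ₗ[ℂ] Matrix B B ℂ} {K : Matrix B A ℂ} (h : ∀ M, Φ M = K * M * Kᴴ)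
    (S : Matrix A W ℂ) : ampl Φ W (pureState S) = pureState (K * S) := by
  ext p q
  simp only [ampl, pureState, Matrix.of_apply, h, Matrix.mul_apply, Matrix.conjTranspose_apply,
    star_sum, star_mul', Finset.sum_mul, Finset.mul_sum]
  refine Finset.sum_congr rfl fun a _ => Finset.sum_congr rfl fun a' _ => ?_
  ring

theorem partialTrace_pureState {A W : Type} [Fintype W] (S : Matrix A W ℂ) :
    partialTrace (pureState S) = S * Sᴴ := by
  ext a a'
  simp [partialTrace, pureState, Matrix.mul_apply]

theorem traceFst_mul_conjTranspose_apply {A B W : Type} [Fintype A] [Fintype W]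
    (S : Matrix (A × B) W ℂ) (b b' : B) :
    traceFst (S * Sᴴ) b b' = ∑ p : A × W, S (p.1, b) p.2 * star (S (p.1, b') p.2) := by
  simp [traceFst, Matrix.mul_apply, Fintype.sum_prod_type]

/-- The verifier prepares a pure state and applies isometries. -/
structure IsPure (V : Interaction) : Prop where
  ρ : ∃ v : V.X 0 × V.Z 0 → ℂ, V.ρ = Matrix.vecMulVec v (star v)
  Ψ : ∀ i : Fin V.m, ∃ A : Matrix (V.X i.succ × V.Z i.succ) (V.Y i.castSucc × V.Z i.castSucc) ℂ,
    ∀ M, (V.Ψ i).map M = A * M * Aᴴ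

/-- Against a pure verifier, all feasible families come from strategies. -/
theorem IsPure.exists_strategy {V : Interaction} (hV : IsPure V)
    {r : ∀ i, Matrix (V.Y i × V.Z i) (V.Y i × V.Z i) ℂ} (hr : IsFeasible V r) :
    ∃ B : Strategy V, ∀ i, partialTrace (B.state i) = r i := by
  obtain ⟨v, hv⟩ := hV.ρ
  choose A hA using hV.Ψ
  -- Bob will hold a purification `S i` of `r i`, with a copy of `ℂ^(Y i × Z i)` as memory.
  have hS : ∀ i, ∃ S : Matrix (V.Y i × V.Z i) (V.Y i × V.Z i) ℂ, r i = S * Sᴴ := fun i => by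
    obtain ⟨S, hS⟩ := exists_eq_conjTranspose_mul_self (hr.posSemidef i)
    exact ⟨Sᴴ, by rw [hS, Matrix.conjTranspose_conjTranspose]⟩
  choose S hS using hS
  -- Since `V.ρ` is pure, Bob's register purifies Alice's memory; `hr.zero` says that `S 0` purifies
  -- the same state.
  have hfirst : ∃ Φ : Channel (V.X 0) (V.Y 0 × (V.Y 0 × V.Z 0)),
      swapLast (ampl Φ.map (V.Z 0) V.ρ) = pureState (S 0) := by
    obtain ⟨Φ, hΦ⟩ := exists_channel_of_marginal_eq (P := V.X 0) (R := V.Y 0 × (V.Y 0 × V.Z 0))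
      (T := Matrix.of fun x z => v (x, z)) (S := Matrix.of fun p z => S 0 (p.1, z) p.2) (by
        intro z z'
        have h := congrFun (congrFun hr.zero z) z'
        rw [hS, traceFst_mul_conjTranspose_apply] at h
        simp only [Matrix.of_apply, h]
        simp [traceFst, hv, Matrix.vecMulVec_apply])
    refine ⟨Φ, ?_⟩
    ext p q
    have h := congrFun (congrFun (hΦ p.1.2 q.1.2) (p.1.1, p.2)) (q.1.1, q.2)
    simpa [swapLast, ampl, pureState, hv, Matrix.vecMulVec_apply] using h
  -- Alice's isometry keeps the joint state pure, so the same argument applies with his old memory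
  -- included in the purifying register.
  have hnext : ∀ i : Fin V.m, ∃ Φ : Channel (V.X i.succ × (V.Y i.castSucc × V.Z i.castSucc))
      (V.Y i.succ × (V.Y i.succ × V.Z i.succ)),
      swapLast (ampl Φ.map (V.Z i.succ) (swapLast (pureState (A i * S i.castSucc)))) =
        pureState (S i.succ) := by
    intro i
    obtain ⟨Φ, hΦ⟩ := exists_channel_of_marginal_eq
      (P := V.X i.succ × (V.Y i.castSucc × V.Z i.castSucc))
      (R := V.Y i.succ × (V.Y i.succ × V.Z i.succ))
      (T := Matrix.of fun p z => (A i * S i.castSucc) (p.1, z) p.2)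
      (S := Matrix.of fun p z => S i.succ (p.1, z) p.2) (by
        intro z z'
        have h := congrFun (congrFun (hr.succ i) z) z'
        have h' : A i * (S i.castSucc * (S i.castSucc)ᴴ) * (A i)ᴴ =
            (A i * S i.castSucc) * (A i * S i.castSucc)ᴴ := by
          rw [Matrix.conjTranspose_mul]
          simp only [Matrix.mul_assoc]
        rw [hS, hA, hS, h', traceFst_mul_conjTranspose_apply,
          traceFst_mul_conjTranspose_apply] at h
        exact h.symm)
    refine ⟨Φ, ?_⟩
    ext p q
    exact congrFun (congrFun (hΦ p.1.2 q.1.2) (p.1.1, p.2)) (q.1.1, q.2)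
  choose Φ hΦ using hfirst
  choose Θ hΘ using hnext
  let B : Strategy V := { W := fun i => V.Y i × V.Z i, first := Φ, next := Θ }
  have hB : ∀ i, B.state i = pureState (S i) := by
    intro i
    induction i using Fin.induction with
    | zero => rw [B.state_zero]; exact hΦ
    | succ i ih => rw [B.state_succ, ih, ampl_pureState (hA i)]; exact hΘ i
  exact ⟨B, fun i => by rw [hB, hS, partialTrace_pureState]⟩

/-! ### Extending the verifier's memory by an environment -/

/-- The sum of the diagonal blocks of an operator on the second tensor factor, for blocks given by
embeddings `j e`.  It is the partial trace over an environment if `j e z = (z, e)`. -/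
def envTrace {A Z Z' E : Type} [Fintype E] (j : E → Z → Z') :
    Matrix (A × Z') (A × Z') ℂ →ₗ[ℂ] Matrix (A × Z) (A × Z) ℂ where
  toFun M := ∑ e, M.submatrix (Prod.map id (j e)) (Prod.map id (j e))
  map_add' M N := by simp [Matrix.submatrix_add, Finset.sum_add_distrib]
  map_smul' c M := by simp [Matrix.submatrix_smul, Finset.smul_sum]

theorem envTrace_apply {A Z Z' E : Type} [Fintype E] (j : E → Z → Z')
    (M : Matrix (A × Z') (A × Z') ℂ) (p q : A × Z) :
    envTrace j M p q = ∑ e, M (p.1, j e p.2) (q.1, j e q.2) := by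
  exact Matrix.sum_apply p q Finset.univ fun e =>
    M.submatrix (Prod.map id (j e)) (Prod.map id (j e))

/-- On product operators this is the expansion of a product of sums over environments. -/
theorem envTrace_submatrix_split {A Z Z' E : Type} [Fintype E] [Fintype A] [Fintype Z']
    [DecidableEq A] [DecidableEq Z'] (j : E → Z → Z') (n : ℕ)
    (M : Matrix (Fin n → A × Z') (Fin n → A × Z') ℂ) :
    envTrace (fun (e : Fin n → E) (z : Fin n → Z) k => j (e k) (z k))
        (M.submatrix (split n A Z').symm (split n A Z').symm) =
      (tensorPow n (envTrace j) M).submatrix (split n A Z).symm (split n A Z).symm := by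
  have : envTrace (fun (e : Fin n → E) (z : Fin n → Z) k => j (e k) (z k)) ∘ₗ
      (Matrix.reindexLinearEquiv ℂ ℂ (split n A Z') (split n A Z')).toLinearMap =
      (Matrix.reindexLinearEquiv ℂ ℂ (split n A Z) (split n A Z)).toLinearMap ∘ₗ
        tensorPow n (envTrace j) := by
    refine tensor_linearMap_ext fun M => ?_
    rw [LinearMap.comp_apply, LinearMap.comp_apply, tensorPow_tensor]
    ext p q
    simp only [LinearEquiv.coe_coe, Matrix.coe_reindexLinearEquiv, Matrix.reindex_apply,
      envTrace_apply, Matrix.submatrix_apply, tensor, Matrix.of_apply, Fintype.prod_sum]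
    rfl
  exact LinearMap.congr_fun this M

theorem tensorPow_envTrace {A B Z₁ Z₁' Z₂ Z₂' E₁ E₂ : Type} [Fintype E₁] [Fintype E₂] [Fintype A]
    [Fintype B] [Fintype Z₁] [Fintype Z₁'] [Fintype Z₂'] [DecidableEq A] [DecidableEq B]
    [DecidableEq Z₁] [DecidableEq Z₁'] [DecidableEq Z₂'] {j₁ : E₁ → Z₁ → Z₁'} {j₂ : E₂ → Z₂ → Z₂'}
    {Φ : Matrix (A × Z₁) (A × Z₁) ℂ →ₗ[ℂ] Matrix (B × Z₂) (B × Z₂) ℂ}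
    {Φ' : Matrix (A × Z₁') (A × Z₁') ℂ →ₗ[ℂ] Matrix (B × Z₂') (B × Z₂') ℂ}
    (h : Φ ∘ₗ envTrace j₁ = envTrace j₂ ∘ₗ Φ') (n : ℕ)
    (M : Matrix ((Fin n → A) × (Fin n → Z₁')) ((Fin n → A) × (Fin n → Z₁')) ℂ) :
    (tensorPow n Φ ((envTrace (fun (e : Fin n → E₁) (z : Fin n → Z₁) k => j₁ (e k) (z k)) M).submatrix
      (split n A Z₁) (split n A Z₁))).submatrix (split n B Z₂).symm (split n B Z₂).symm =
    envTrace (fun (e : Fin n → E₂) (z : Fin n → Z₂) k => j₂ (e k) (z k))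
      ((tensorPow n Φ' (M.submatrix (split n A Z₁') (split n A Z₁'))).submatrix
        (split n B Z₂').symm (split n B Z₂').symm) := by
  have h1 := envTrace_submatrix_split (A := A) j₁ n (M.submatrix (split n _ _) (split n _ _))
  rw [Matrix.submatrix_submatrix, Equiv.self_comp_symm, Matrix.submatrix_id_id] at h1
  rw [envTrace_submatrix_split (A := B) j₂ n, ← LinearMap.comp_apply (tensorPow n (envTrace j₂)),
    ← tensorPow_comp, ← h, tensorPow_comp, LinearMap.comp_apply, h1, Matrix.submatrix_submatrix,
    Equiv.symm_comp_self, Matrix.submatrix_id_id]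

theorem trace_thresholdPOVM_mul_envTrace {A Z Z' E : Type} [Fintype E] [Fintype A] [Fintype Z]
    [Fintype Z'] [DecidableEq A] [DecidableEq Z'] {j : E → Z → Z'}
    {P : Fin 2 → Matrix (A × Z) (A × Z) ℂ} {P' : Fin 2 → Matrix (A × Z') (A × Z') ℂ}
    (h : ∀ o M, (P' o * M).trace = (P o * envTrace j M).trace) (n k : ℕ) (o : Fin 2)
    (M : Matrix ((Fin n → A) × (Fin n → Z')) ((Fin n → A) × (Fin n → Z')) ℂ) :
    ((thresholdPOVM P' n k o).submatrix (split n A Z').symm (split n A Z').symm * M).trace =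
      ((thresholdPOVM P n k o).submatrix (split n A Z).symm (split n A Z).symm *
        envTrace (fun (e : Fin n → E) (z : Fin n → Z) k => j (e k) (z k)) M).trace := by
  have h1 := envTrace_submatrix_split (A := A) j n (M.submatrix (split n _ _) (split n _ _))
  rw [Matrix.submatrix_submatrix, Equiv.self_comp_symm, Matrix.submatrix_id_id] at h1
  rw [h1, trace_submatrix_mul_submatrix, ← trace_submatrix_mul_submatrix (split n A Z'),
    Matrix.submatrix_submatrix, Equiv.symm_comp_self, Matrix.submatrix_id_id]
  simp only [thresholdPOVM, Matrix.sum_mul, Matrix.trace_sum]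
  exact Finset.sum_congr rfl fun w _ => trace_tensor_mul_tensorPow (fun l => h (w l)) _

/-- A verifier who behaves as the one in `V` but has a larger memory, from which the memory in `V`
is obtained by discarding an environment. -/
structure Extension (V : Interaction) where
  Z : Fin (V.m + 1) → Type
  [fintypeZ : ∀ i, Fintype (Z i)]
  [decidableEqZ : ∀ i, DecidableEq (Z i)]
  [nonemptyZ : ∀ i, Nonempty (Z i)]
  E : Fin (V.m + 1) → Type
  [fintypeE : ∀ i, Fintype (E i)]
  j : ∀ i, E i → V.Z i → Z i
  ρ : Matrix (V.X 0 × Z 0) (V.X 0 × Z 0) ℂ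
  ρ_density : IsDensity ρ
  Ψ : ∀ i : Fin V.m, Channel (V.Y i.castSucc × Z i.castSucc) (V.X i.succ × Z i.succ)
  P : Fin 2 → Matrix (V.Y (Fin.last V.m) × Z (Fin.last V.m)) (V.Y (Fin.last V.m) × Z (Fin.last V.m)) ℂ
  P_povm : IsBinaryPOVM P
  envTrace_ρ : envTrace (j 0) ρ = V.ρ
  envTrace_Ψ : ∀ i : Fin V.m, (V.Ψ i).map ∘ₗ envTrace (j i.castSucc) =
    envTrace (j i.succ) ∘ₗ (Ψ i).map
  trace_P : ∀ o M, (P o * M).trace = (V.P o * envTrace (j (Fin.last V.m)) M).trace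

attribute [instance] Extension.fintypeZ Extension.decidableEqZ Extension.nonemptyZ
  Extension.fintypeE

namespace Extension

variable {V : Interaction} (D : Extension V)

/-- The interaction with the extended verifier. -/
abbrev toInteraction : Interaction where
  m := V.m
  X := V.X
  Y := V.Y
  Z := D.Z
  ρ := D.ρ
  ρ_density := D.ρ_density
  Ψ := D.Ψ
  P := D.P
  P_povm := D.P_povm

/-- A strategy against a verifier, used against the extended verifier. -/
abbrev lift (B : Strategy V) : Strategy D.toInteraction where
  W := B.W
  first := B.first
  next := B.next

/-- Discarding the environment commutes with Alice's channels by `envTrace_Ψ`, and with Bob's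
because they act on other factors. -/
theorem state_eq (B : Strategy V) (i : Fin (V.m + 1)) :
    B.state i = ∑ e, ((D.lift B).state i).submatrix (Prod.map (Prod.map id (D.j i e)) id)
      (Prod.map (Prod.map id (D.j i e)) id) := by
  induction i using Fin.induction with
  | zero =>
    rw [B.state_zero, (D.lift B).state_zero]
    ext ⟨⟨y, z⟩, w⟩ ⟨⟨y', z'⟩, w'⟩
    simp only [Matrix.sum_apply, swapLast, ampl, Matrix.submatrix_apply, Matrix.of_apply,
      Prod.map, id]
    rw [← Matrix.sum_apply, ← map_sum]
    refine congrFun (congrFun (congrArg _ ?_) _) _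
    ext x x'
    rw [Matrix.of_apply, ← D.envTrace_ρ, envTrace_apply, Matrix.sum_apply]
    rfl
  | succ i ih =>
    rw [B.state_succ, (D.lift B).state_succ]
    ext ⟨⟨y, z⟩, w⟩ ⟨⟨y', z'⟩, w'⟩
    simp only [Matrix.sum_apply, swapLast, ampl, Matrix.submatrix_apply, Matrix.of_apply,
      Prod.map, id]
    rw [← Matrix.sum_apply, ← map_sum]
    refine congrFun (congrFun (congrArg _ ?_) _) _
    ext ⟨x, w⟩ ⟨x', w'⟩
    have h := LinearMap.congr_fun (D.envTrace_Ψ i)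
      (Matrix.of fun a a' => (D.lift B).state i.castSucc (a, w) (a', w'))
    have h' := congrFun (congrFun h (x, z)) (x', z')
    rw [LinearMap.comp_apply, LinearMap.comp_apply, envTrace_apply] at h'
    rw [Matrix.of_apply, Matrix.sum_apply, ih]
    refine Eq.trans ?_ h'
    refine congrFun (congrFun (congrArg _ ?_) _) _
    ext p q
    simp [envTrace_apply, Matrix.sum_apply, Prod.map]

theorem winProb_lift (B : Strategy V) : (D.lift B).winProb = B.winProb := by
  rw [Strategy.winProb, Strategy.winProb, D.trace_P 1]
  congr 3
  rw [D.state_eq B]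
  ext p q
  simp only [envTrace_apply, partialTrace, Matrix.of_apply, Matrix.sum_apply,
    Matrix.submatrix_apply, Prod.map]
  exact Finset.sum_comm

/-- An extension leaves the messages unchanged, so the same channels form a strategy against `V`. -/
theorem winProb_le_value (B : Strategy D.toInteraction) : B.winProb ≤ V.value := by
  let B' : Strategy V := { W := B.W, first := B.first, next := B.next }
  have h : B.winProb = B'.winProb := D.winProb_lift B'
  rw [h]
  exact V.isLUB_value.1 (Set.mem_range_self B')

/-- The extension of the repeated interaction by repetition of the extended verifier. -/
def repeatThreshold (n k : ℕ) : Extension (V.repeatThreshold n k) where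
  Z := fun i : Fin (V.m + 1) => Fin n → D.Z i
  fintypeZ := fun i : Fin (V.m + 1) => (inferInstance : Fintype (Fin n → D.Z i))
  decidableEqZ := fun i : Fin (V.m + 1) => (inferInstance : DecidableEq (Fin n → D.Z i))
  nonemptyZ := fun i : Fin (V.m + 1) => (inferInstance : Nonempty (Fin n → D.Z i))
  E := fun i : Fin (V.m + 1) => Fin n → D.E i
  fintypeE := fun i : Fin (V.m + 1) => (inferInstance : Fintype (Fin n → D.E i))
  -- The copies may store memory and environment jointly in each coordinate, which is why `envTrace`
  -- allows embeddings other than pairing.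
  j := fun (i : Fin (V.m + 1)) e z l => D.j i (e l) (z l)
  ρ := (D.toInteraction.repeatThreshold n k).ρ
  ρ_density := (D.toInteraction.repeatThreshold n k).ρ_density
  Ψ := (D.toInteraction.repeatThreshold n k).Ψ
  P := (D.toInteraction.repeatThreshold n k).P
  P_povm := (D.toInteraction.repeatThreshold n k).P_povm
  envTrace_ρ := by
    have h := envTrace_submatrix_split (A := V.X 0) (D.j 0) n (tensor fun _ => D.ρ)
    rw [tensorPow_tensor, D.envTrace_ρ] at h
    exact h
  envTrace_Ψ := fun i : Fin V.m => LinearMap.ext (tensorPow_envTrace (D.envTrace_Ψ i) n)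
  trace_P := trace_thresholdPOVM_mul_envTrace D.trace_P n k

end Extension

/-! ### Purification of the verifier -/

/-- The operator `∑ l, K l ⊗ |l⟩` that records the index of the Kraus operator in the environment. -/
def dilate {X Y Z₁ Z₂ L E₁ E₂ : Type} [DecidableEq E₁] (e : E₂ ≃ L × E₁)
    (K : L → Matrix (X × Z₂) (Y × Z₁) ℂ) : Matrix (X × (Z₂ × E₂)) (Y × (Z₁ × E₁)) ℂ :=
  Matrix.of fun p q => if (e p.2.2).2 = q.2.2 then K (e p.2.2).1 (p.1, p.2.1) (q.1, q.2.1) else 0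

theorem dilate_conjTranspose_mul_self {X Y Z₁ Z₂ L E₁ E₂ : Type} [Fintype X] [Fintype Z₂]
    [Fintype L] [Fintype E₁] [Fintype E₂] [DecidableEq Y] [DecidableEq Z₁] [DecidableEq E₁]
    (e : E₂ ≃ L × E₁) {K : L → Matrix (X × Z₂) (Y × Z₁) ℂ} (hK : ∑ l, (K l)ᴴ * K l = 1) :
    (dilate e K)ᴴ * dilate e K = 1 := by
  ext ⟨y, z, c⟩ ⟨y', z', c'⟩
  have h := congrFun (congrFun hK (y, z)) (y', z')
  simp only [Matrix.sum_apply, Matrix.mul_apply, Matrix.conjTranspose_apply,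
    Fintype.sum_prod_type] at h
  simp only [Matrix.mul_apply, Matrix.conjTranspose_apply, Fintype.sum_prod_type, dilate,
    Matrix.of_apply]
  have h1 : ∀ x w, ∑ c₂ : E₂, (star (if (e c₂).2 = c then K (e c₂).1 (x, w) (y, z) else 0) *
      if (e c₂).2 = c' then K (e c₂).1 (x, w) (y', z') else 0) =
      if c = c' then ∑ l, star (K l (x, w) (y, z)) * K l (x, w) (y', z') else 0 := by
    intro x w
    rw [Equiv.sum_comp e fun q => (star (if q.2 = c then K q.1 (x, w) (y, z) else 0) *
      if q.2 = c' then K q.1 (x, w) (y', z') else 0), Fintype.sum_prod_type]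
    split_ifs with hc
    · subst hc
      refine Finset.sum_congr rfl fun l _ => ?_
      rw [Finset.sum_eq_single c (fun b _ hb => by simp [hb]) (by simp)]
      simp
    · refine Finset.sum_eq_zero fun l _ => Finset.sum_eq_zero fun b _ => ?_
      by_cases hb : b = c
      · subst hb; simp [hc]
      · simp [hb]
  simp only [h1]
  by_cases hc : c = c'
  · subst hc
    simp only [if_true]
    rw [Matrix.one_apply] at h ⊢
    simp only [Prod.mk.injEq, and_true] at h ⊢
    rw [← h]
    symm
    rw [Finset.sum_comm]
    exact Finset.sum_congr rfl fun x _ => Finset.sum_comm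
  · simp [hc]

/-- Stinespring dilation: a new environment state is a Kraus index together with an old environment
state, so tracing it out sums over both. -/
theorem envTrace_dilate {X Y Z₁ Z₂ L E₁ E₂ : Type} [Fintype Y] [Fintype Z₁]
    [Fintype L] [Fintype E₁] [Fintype E₂] [DecidableEq E₁]
    (e : E₂ ≃ L × E₁) (K : L → Matrix (X × Z₂) (Y × Z₁) ℂ)
    (M : Matrix (Y × (Z₁ × E₁)) (Y × (Z₁ × E₁)) ℂ) :
    envTrace (fun e z => (z, e)) (dilate e K * M * (dilate e K)ᴴ) =
      ∑ l, K l * envTrace (fun e z => (z, e)) M * (K l)ᴴ := by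
  have h : ∀ p q c, (dilate e K * M * (dilate e K)ᴴ) (p.1, (p.2, c)) (q.1, (q.2, c)) =
      (K (e c).1 * M.submatrix (Prod.map id fun z => (z, (e c).2))
        (Prod.map id fun z => (z, (e c).2)) * (K (e c).1)ᴴ) p q := by
    intro p q c
    simp only [Matrix.mul_apply, Matrix.conjTranspose_apply, Fintype.sum_prod_type, dilate,
      Matrix.of_apply, ite_mul, zero_mul, Finset.sum_ite_eq, Finset.mem_univ, if_true,
      apply_ite star, star_zero, mul_ite, mul_zero, Matrix.submatrix_apply, Prod.map, id]
  ext p q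
  rw [envTrace_apply]
  simp only [h]
  rw [Equiv.sum_comp e fun r => (K r.1 * M.submatrix (Prod.map id fun z => (z, r.2))
        (Prod.map id fun z => (z, r.2)) * (K r.1)ᴴ) p q, Fintype.sum_prod_type, Matrix.sum_apply]
  refine Finset.sum_congr rfl fun l _ => ?_
  rw [← Matrix.sum_apply]
  simp only
  rw [← Matrix.sum_mul, ← Matrix.mul_sum]
  rfl

theorem sum_conjTranspose_mul_self_of_krausMap {A B ι : Type} [Fintype A] [DecidableEq A]
    [Fintype B] [Fintype ι] {K : ι → Matrix B A ℂ}
    (h : ∀ M, (krausMap K M).trace = M.trace) : ∑ l, (K l)ᴴ * K l = 1 := by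
  refine Matrix.ext_iff_trace_mul_right.mpr fun M => ?_
  have h1 := h M
  rw [krausMap_apply, Matrix.trace_sum] at h1
  simp_rw [Matrix.mul_assoc, Matrix.trace_mul_comm (K _), Matrix.mul_assoc] at h1
  rw [← Matrix.trace_sum, ← Matrix.mul_sum, Matrix.trace_mul_comm] at h1
  rw [h1, Matrix.one_mul]

/-- Padding with zero operators lets all channels of a verifier share one set of Kraus labels. -/
theorem exists_krausMap {A B : Type} [Fintype A] [Fintype B]
    {Φ : Matrix A A ℂ →ₗ[ℂ] Matrix B B ℂ} (h : IsCompletelyPositive Φ) {N : ℕ}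
    (hN : Fintype.card (B × A) ≤ N) : ∃ K : Fin N → Matrix B A ℂ, Φ = krausMap K := by
  classical
  obtain ⟨K, hK⟩ := exists_kraus h
  obtain ⟨f⟩ := Function.Embedding.nonempty_of_card_le (hN.trans_eq (Fintype.card_fin N).symm)
  refine ⟨Function.extend f K 0, LinearMap.ext fun M => ?_⟩
  have h1 : ∀ M, krausMap (Function.extend f K 0) M = krausMap K M := fun M => by
    rw [krausMap_apply, krausMap_apply]
    refine (Fintype.sum_of_injective f f.injective _ _ (fun i hi => ?_) fun i => ?_).symm
    · rw [Function.extend_apply' _ _ _ hi]; simp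
    · rw [f.injective.extend_apply]
  rw [h1]
  conv_lhs => rw [Matrix.matrix_eq_sum_single M]
  conv_rhs => rw [Matrix.matrix_eq_sum_single M]
  simp only [map_sum]
  refine Finset.sum_congr rfl fun a _ => Finset.sum_congr rfl fun a' _ => ?_
  rw [show Matrix.single a a' (M a a') = M a a' • Matrix.single a a' (1 : ℂ) by
    simp [Matrix.smul_single], map_smul, map_smul]
  congr 1
  ext b b'
  rw [hK, krausMap_apply, Matrix.sum_apply]
  refine Finset.sum_congr rfl fun l _ => ?_
  simp [Matrix.mul_apply, Matrix.single_apply, ite_and]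

/-- A verifier's memory extended by the environments of her channels. -/
def purification (V : Interaction) {L : Type} [Fintype L] [DecidableEq L] [Nonempty L]
    {u : L → V.X 0 × V.Z 0 → ℂ} (hu : V.ρ = ∑ l, Matrix.vecMulVec (u l) (star (u l)))
    {K : ∀ i : Fin V.m, L → Matrix (V.X i.succ × V.Z i.succ) (V.Y i.castSucc × V.Z i.castSucc) ℂ}
    (hK : ∀ i, (V.Ψ i).map = krausMap (K i)) : Extension V where
  -- The environment holds one label for the rank-one decomposition of `V.ρ` and one for each
  -- channel applied so far, the newest at index `0`.
  Z i := V.Z i × (Fin (i.val + 1) → L)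
  E i := Fin (i.val + 1) → L
  j _ e z := (z, e)
  ρ := Matrix.vecMulVec (fun p => u (p.2.2 0) (p.1, p.2.1))
    (star fun p => u (p.2.2 0) (p.1, p.2.1))
  ρ_density := by
    refine ⟨Matrix.posSemidef_vecMulVec_self_star _, ?_⟩
    rw [← V.ρ_density.2, hu]
    simp only [Matrix.trace, Matrix.diag_apply, Matrix.sum_apply, Matrix.vecMulVec_apply,
      Pi.star_apply, Fintype.sum_prod_type]
    refine Finset.sum_congr rfl fun x _ => Finset.sum_congr rfl fun z _ => ?_
    exact Equiv.sum_comp (Equiv.funUnique (Fin 1) L) fun l => u l (x, z) * star (u l (x, z))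
  Ψ i := Channel.ofKraus (fun _ : Unit =>
      dilate (E₁ := Fin (i.val + 1) → L) (Fin.consEquiv fun _ : Fin (i.val + 2) => L).symm (K i)) (by
    rw [Fintype.sum_unique]
    exact dilate_conjTranspose_mul_self _ (sum_conjTranspose_mul_self_of_krausMap fun M => by
      rw [← hK, (V.Ψ i).tracePreserving]))
  P o := (V.P o ⊗ₖ (1 : Matrix (Fin (V.m + 1) → L) (Fin (V.m + 1) → L) ℂ)).submatrix
    (Equiv.prodAssoc _ _ _).symm (Equiv.prodAssoc _ _ _).symm
  P_povm := by
    refine ⟨fun o => (Matrix.PosSemidef.kronecker (V.P_povm.1 o) Matrix.PosSemidef.one).submatrix _,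
      ?_⟩
    have h := congrArg (fun N => Matrix.submatrix (N ⊗ₖ (1 : Matrix (Fin (V.m + 1) → L)
      (Fin (V.m + 1) → L) ℂ)) (Equiv.prodAssoc _ _ _).symm (Equiv.prodAssoc _ _ _).symm) V.P_povm.2
    simp only [Matrix.add_kronecker, Matrix.one_kronecker_one, Matrix.submatrix_one_equiv] at h
    exact h
  envTrace_ρ := by
    ext p q
    rw [envTrace_apply, hu, Matrix.sum_apply]
    exact Equiv.sum_comp (Equiv.funUnique (Fin 1) L) fun l => u l p * star (u l q)
  envTrace_Ψ i := by
    refine LinearMap.ext fun M => ?_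
    rw [LinearMap.comp_apply, LinearMap.comp_apply, Channel.ofKraus_map, Fintype.sum_unique]
    refine (LinearMap.congr_fun (hK i) _).trans ?_
    exact (envTrace_dilate (E₁ := Fin (i.val + 1) → L)
      (Fin.consEquiv fun _ : Fin (i.val + 2) => L).symm (K i) M).symm
  trace_P o M := by
    simp only [Matrix.trace, Matrix.diag_apply, Matrix.mul_apply, envTrace_apply,
      Fintype.sum_prod_type, Matrix.submatrix_apply, Matrix.kroneckerMap_apply, Matrix.one_apply,
      Equiv.prodAssoc_symm_apply, mul_ite, mul_one, mul_zero, ite_mul, zero_mul,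
      Finset.sum_ite_eq, Finset.mem_univ, if_true, Finset.mul_sum]
    refine Finset.sum_congr rfl fun y _ => Finset.sum_congr rfl fun z _ => ?_
    rw [Finset.sum_comm]
    exact Finset.sum_congr rfl fun y' _ => Finset.sum_comm

theorem purification_isPure (V : Interaction) {L : Type} [Fintype L] [DecidableEq L] [Nonempty L]
    {u : L → V.X 0 × V.Z 0 → ℂ} (hu : V.ρ = ∑ l, Matrix.vecMulVec (u l) (star (u l)))
    {K : ∀ i : Fin V.m, L → Matrix (V.X i.succ × V.Z i.succ) (V.Y i.castSucc × V.Z i.castSucc) ℂ}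
    (hK : ∀ i, (V.Ψ i).map = krausMap (K i)) : IsPure (purification V hu hK).toInteraction where
  ρ := ⟨_, rfl⟩
  Ψ := fun i : Fin V.m => by
    let A := dilate (E₁ := Fin (i.val + 1) → L)
      (Fin.consEquiv fun _ : Fin (i.val + 2) => L).symm (K i)
    exact ⟨A, fun (M : Matrix (V.Y i.castSucc × V.Z i.castSucc × (Fin (i.val + 1) → L))
      (V.Y i.castSucc × V.Z i.castSucc × (Fin (i.val + 1) → L)) ℂ) => Fintype.sum_unique fun _ : Unit => A * M * Aᴴ⟩

/-- Every verifier can be extended to a pure one. -/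
theorem exists_extension_isPure (V : Interaction) : ∃ D : Extension V, IsPure D.toInteraction := by
  obtain ⟨S, hS⟩ := exists_eq_conjTranspose_mul_self V.ρ_density.1
  obtain ⟨N, hN⟩ := (Set.finite_range fun i : Fin V.m => Fintype.card
    ((V.X i.succ × V.Z i.succ) × (V.Y i.castSucc × V.Z i.castSucc))).bddAbove
  -- One label set large enough for all the channels and for `V.ρ`; the `+ 1` makes it nonempty.
  let N' := max (N + 1) (Fintype.card (V.X 0 × V.Z 0))
  have : Nonempty (Fin N') := ⟨⟨0, by positivity⟩⟩
  have hK := fun i => exists_krausMap (V.Ψ i).completelyPositive (N := N')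
    ((hN (Set.mem_range_self i)).trans ((Nat.le_succ N).trans (le_max_left _ _)))
  choose K hK using hK
  obtain ⟨f⟩ := Function.Embedding.nonempty_of_card_le (α := V.X 0 × V.Z 0) (β := Fin N')
    ((le_max_right _ _).trans_eq (Fintype.card_fin N').symm)
  have hu : V.ρ = ∑ l, Matrix.vecMulVec (Function.extend f (fun l p => star (S l p)) 0 l)
      (star (Function.extend f (fun l p => star (S l p)) 0 l)) := by
    have h : V.ρ = ∑ l, Matrix.vecMulVec (fun p => star (S l p)) (star fun p => star (S l p)) := by
      rw [hS]
      ext p q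
      simp [Matrix.mul_apply, Matrix.sum_apply, Matrix.vecMulVec_apply]
    rw [h]
    refine Fintype.sum_of_injective f f.injective _ _ (fun i hi => ?_) fun i => ?_
    · rw [Function.extend_apply' _ _ _ hi]; simp
    · rw [f.injective.extend_apply]
  exact ⟨purification V hu hK, purification_isPure V hu hK⟩

/-- If Bob's optimal winning probability is at most `a`, then for all `x ≥ 1` his optimal probability
to win at least `k` of `n` parallel instances is bounded as for independent instances. -/
theorem winProb_repeatThreshold_le {V : Interaction} {a : ℝ} (h : V.value ≤ a) {x c : ℝ}
    (hx : 1 ≤ x) (hc : 1 + (x - 1) * a < c) {n k : ℕ} (B : Strategy (V.repeatThreshold n k)) :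
    x ^ k * B.winProb ≤ c ^ n := by
  obtain ⟨D, hD⟩ := exists_extension_isPure V
  have hQ : (D.P 0 + (x : ℂ) • D.P 1).PosSemidef :=
    (D.P_povm.1 0).add ((D.P_povm.1 1).smul (Complex.zero_le_real.mpr (by linarith)))
  -- The payoff is `1 + (x - 1) P 1`, and purity makes each feasible family the reduced states of a
  -- strategy.
  have hval : ∀ r, IsFeasible D.toInteraction r →
      ((D.P 0 + (x : ℂ) • D.P 1) * r (Fin.last V.m)).trace.re ≤ 1 + (x - 1) * a := by
    intro r hr
    obtain ⟨B, hB⟩ := hD.exists_strategy hr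
    have h1 : (D.P 1 * r (Fin.last V.m)).trace.re ≤ a := by
      refine le_trans (le_of_eq ?_) ((D.winProb_le_value B).trans h)
      rw [← hB]
      rfl
    have h2 : (r (Fin.last V.m)).trace = 1 := by
      rw [← hB]
      exact (Strategy.isDensity_partialTrace (B.state_isDensity (Fin.last V.m))).2
    have h3 : D.P 0 + (x : ℂ) • D.P 1 = 1 + ((x - 1 : ℝ) : ℂ) • D.P 1 := by
      rw [← D.P_povm.2, Complex.ofReal_sub, sub_smul, Complex.ofReal_one, one_smul]
      abel
    rw [h3, Matrix.add_mul, Matrix.one_mul, Matrix.trace_add, h2, Matrix.smul_mul,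
      Matrix.trace_smul, smul_eq_mul, Complex.add_re, Complex.re_ofReal_mul, Complex.one_re]
    have := mul_le_mul_of_nonneg_left h1 (sub_nonneg.mpr hx)
    linarith
  -- Separation yields dual solutions of every value above the bound, whence the strict inequality
  -- in `hc`.
  obtain ⟨H, hH⟩ := exists_isDualFeasible hD.Ψ hQ hval hc
  rw [← (D.repeatThreshold n k).winProb_lift B]
  exact hH.winProb_le hx ((D.repeatThreshold n k).lift B)

/-! ### Independent play -/

theorem tensorPow_prod {A B : Type} [Fintype A] [DecidableEq A] {n : ℕ}
    (Φ : Matrix A A ℂ →ₗ[ℂ] Matrix B B ℂ) (M : Fin n → A → A → ℂ) (b b' : Fin n → B) :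
    tensorPow n Φ (Matrix.of fun a a' => ∏ k, M k (a k) (a' k)) b b' =
      ∏ k, Φ (Matrix.of (M k)) (b k) (b' k) :=
  congrFun (congrFun (tensorPow_tensor Φ fun k => Matrix.of (M k)) b) b'

namespace Strategy

variable {V : Interaction}

open scoped Classical in
/-- The strategy that plays `B` independently in each of `n` parallel instances. -/
def pow (B : Strategy V) (n k : ℕ) : Strategy (V.repeatThreshold n k) where
  W := fun i : Fin (V.m + 1) => Fin n → B.W i
  fintypeW := fun i : Fin (V.m + 1) => (inferInstance : Fintype (Fin n → B.W i))
  first := ((B.first.pow n).reindex (Equiv.refl (Fin n → V.X 0)) (split n (V.Y 0) (B.W 0)) :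
    Channel (Fin n → V.X 0) ((Fin n → V.Y 0) × (Fin n → B.W 0)))
  next := fun i : Fin V.m => (((B.next i).pow n).reindex (split n (V.X i.succ) (B.W i.castSucc))
    (split n (V.Y i.succ) (B.W i.succ)) :
    Channel ((Fin n → V.X i.succ) × (Fin n → B.W i.castSucc))
      ((Fin n → V.Y i.succ) × (Fin n → B.W i.succ)))

/-- Alice's and Bob's maps are both tensor powers, so the joint state remains a product over the
instances. -/
theorem pow_state (B : Strategy V) (n k : ℕ) (i : Fin (V.m + 1)) :
    (B.pow n k).state i = (Matrix.of fun p q => ∏ l,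
      B.state i ((p.1.1 l, p.1.2 l), p.2 l) ((q.1.1 l, q.1.2 l), q.2 l) :
      Matrix (((Fin n → V.Y i) × (Fin n → V.Z i)) × (Fin n → B.W i))
        (((Fin n → V.Y i) × (Fin n → V.Z i)) × (Fin n → B.W i)) ℂ) := by
  classical
  induction i using Fin.induction with
  | zero =>
    rw [B.state_zero]
    ext ⟨⟨y, z⟩, w⟩ ⟨⟨y', z'⟩, w'⟩
    exact tensorPow_prod B.first.map (fun l x x' => V.ρ (x, z l) (x', z' l))
      (fun l => (y l, w l)) fun l => (y' l, w' l)
  | succ i ih =>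
    -- One round of the recursion, with types spelled out so that it unfolds definitionally.
    let F : Matrix (((Fin n → V.Y i.castSucc) × (Fin n → V.Z i.castSucc)) × (Fin n → B.W i.castSucc))
        (((Fin n → V.Y i.castSucc) × (Fin n → V.Z i.castSucc)) × (Fin n → B.W i.castSucc)) ℂ →
        Matrix (((Fin n → V.Y i.succ) × (Fin n → V.Z i.succ)) × (Fin n → B.W i.succ))
        (((Fin n → V.Y i.succ) × (Fin n → V.Z i.succ)) × (Fin n → B.W i.succ)) ℂ := fun σ =>
      swapLast (ampl (((B.next i).pow n).reindex (split n (V.X i.succ) (B.W i.castSucc))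
        (split n (V.Y i.succ) (B.W i.succ))).map (Fin n → V.Z i.succ)
        (swapLast (ampl (((V.Ψ i).pow n).reindex (split n _ _) (split n _ _)).map
          (Fin n → B.W i.castSucc) σ)))
    have hs : (B.pow n k).state i.succ = F _ := congrArg F ih
    rw [hs]
    ext ⟨⟨y, z⟩, w⟩ ⟨⟨y', z'⟩, w'⟩
    refine Eq.trans ?_ (tensorPow_prod (B.next i).map (fun l p p' =>
      (V.Ψ i).map (Matrix.of fun a a' => B.state i.castSucc (a, p.2) (a', p'.2))
        (p.1, z l) (p'.1, z' l)) (fun l => (y l, w l)) fun l => (y' l, w' l))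
    refine congrFun (congrFun (congrArg (fun N => tensorPow n (B.next i).map N) (?_ :
      (_ : Matrix (Fin n → V.X i.succ × B.W i.castSucc) (Fin n → V.X i.succ × B.W i.castSucc) ℂ) =
        _)) fun l => (y l, w l)) fun l => (y' l, w' l)
    ext a a'
    exact tensorPow_prod (V.Ψ i).map
      (fun l c c' => B.state i.castSucc (c, (a l).2) (c', (a' l).2))
      (fun l => ((a l).1, z l)) fun l => ((a' l).1, z' l)

theorem pow_winProb (B : Strategy V) (n k : ℕ) : (B.pow n k).winProb =
    ∑ w : Fin n → Fin 2 with k ≤ (Finset.univ.filter fun j => w j = 1).card,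
      ∏ j, ![1 - B.winProb, B.winProb] (w j) := by
  set r := partialTrace (B.state (Fin.last V.m)) with hr
  have hrd : IsDensity r := isDensity_partialTrace (B.state_isDensity (Fin.last V.m))
  have h1 : partialTrace (W := Fin n → B.W (Fin.last V.m)) ((B.pow n k).state (Fin.last V.m)) = (tensor fun _ : Fin n => r).submatrix
      (split n (V.Y (Fin.last V.m)) (V.Z (Fin.last V.m))).symm
      (split n (V.Y (Fin.last V.m)) (V.Z (Fin.last V.m))).symm := by
    rw [pow_state]
    ext p q
    exact (Fintype.prod_sum fun (l : Fin n) w =>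
      B.state (Fin.last V.m) ((p.1 l, p.2 l), w) ((q.1 l, q.2 l), w)).symm
  have h2 : ∀ o, (V.P o * r).trace = ((![1 - B.winProb, B.winProb] o : ℝ) : ℂ) := by
    have h3 : (V.P 1 * r).trace = (B.winProb : ℂ) :=
      Complex.ext rfl (Complex.nonneg_iff.mp (trace_mul_nonneg (V.P_povm.1 1) hrd.1)).2.symm
    intro o
    rcases Fin.exists_fin_two.mp ⟨o, rfl⟩ with rfl | rfl
    · have h4 : (V.P 0 * r).trace + (V.P 1 * r).trace = 1 := by
        rw [← Matrix.trace_add, ← Matrix.add_mul, V.P_povm.2, Matrix.one_mul, hrd.2]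
      rw [h3] at h4
      simpa using eq_sub_of_add_eq h4
    · simpa using h3
  have h5 : (thresholdPOVM V.P n k 1 * tensor fun _ : Fin n => r).trace =
      ((∑ w : Fin n → Fin 2 with k ≤ (Finset.univ.filter fun j => w j = 1).card,
        ∏ j, ![1 - B.winProb, B.winProb] (w j) : ℝ) : ℂ) := by
    simp only [thresholdPOVM, Matrix.sum_mul, Matrix.trace_sum, tensor_mul, tensor_trace, h2,
      true_iff]
    push_cast
    rfl
  have h6 := trace_submatrix_mul_submatrix (split n (V.Y (Fin.last V.m))
    (V.Z (Fin.last V.m))).symm (thresholdPOVM V.P n k 1) (tensor fun _ : Fin n => r)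
  rw [← h1, h5] at h6
  exact congrArg Complex.re h6

/-- The lower tail of the number of instances that are won by independent play. -/
theorem rpow_mul_one_sub_pow_winProb_le (B : Strategy V) {n k : ℕ} {y s : ℝ} (hy : 0 < y)
    (hy1 : y ≤ 1) (hk : ∀ j < k, (j : ℝ) ≤ s) :
    y ^ s * (1 - (B.pow n k).winProb) ≤ (1 - B.winProb + y * B.winProb) ^ n := by
  set q : Fin 2 → ℝ := ![1 - B.winProb, B.winProb] with hq
  have hq0 : ∀ o, 0 ≤ q o := by
    intro o
    rcases Fin.exists_fin_two.mp ⟨o, rfl⟩ with rfl | rfl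
    · simpa [hq] using B.winProb_mem.2
    · simpa [hq] using B.winProb_mem.1
  have h1 : ∑ w : Fin n → Fin 2, ∏ j, q (w j) = 1 := by
    rw [← Fintype.prod_sum fun _ : Fin n => q]
    simp [hq, Fin.sum_univ_two]
  have h2 : ∑ w : Fin n → Fin 2, y ^ (Finset.univ.filter fun j => w j = 1).card * ∏ j, q (w j) =
      (1 - B.winProb + y * B.winProb) ^ n := by
    have h4 : ∀ w : Fin n → Fin 2, y ^ (Finset.univ.filter fun j => w j = 1).card *
        ∏ j, q (w j) = ∏ j, ![1, y] (w j) * q (w j) := fun w => by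
      rw [← prod_outcomes, ← Finset.prod_mul_distrib]
    simp only [h4]
    rw [← Fintype.prod_sum fun (_ : Fin n) o => ![1, y] o * q o]
    simp [hq, Fin.sum_univ_two]
  have h3 : 1 - (B.pow n k).winProb = ∑ w : Fin n → Fin 2 with
      ¬ k ≤ (Finset.univ.filter fun j => w j = 1).card, ∏ j, q (w j) := by
    rw [← Finset.sum_filter_add_sum_filter_not Finset.univ
      (fun w : Fin n → Fin 2 => k ≤ (Finset.univ.filter fun j => w j = 1).card)] at h1
    rw [pow_winProb]
    linarith
  rw [← h2, h3, Finset.mul_sum]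
  -- On strings with fewer than `k` wins, `y ^ s ≤ y ^ wins` because `y ≤ 1`; the remaining strings
  -- only enlarge the moment.
  refine (Finset.sum_le_sum fun w hw => ?_).trans
    (Finset.sum_le_sum_of_subset_of_nonneg (Finset.filter_subset _ _) fun w _ _ =>
      mul_nonneg (pow_nonneg hy.le _) (Finset.prod_nonneg fun j _ => hq0 _))
  refine mul_le_mul_of_nonneg_right ?_ (Finset.prod_nonneg fun j _ => hq0 _)
  rw [← Real.rpow_natCast]
  exact Real.rpow_le_rpow_of_exponent_ge hy hy1
    (hk _ (not_le.mp (Finset.mem_filter.mp hw).2))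

end Strategy

/-! ### Chernoff bounds -/

theorem exp_neg_mul_le {γ ε : ℝ} {n : ℕ} (hγ : 0 < γ) (hε : 0 < ε)
    (hn : 128 / γ ^ 2 * Real.log (1 / ε) ≤ n) : Real.exp (-(n * (γ ^ 2 / 128))) ≤ ε := by
  rw [← Real.le_log_iff_exp_le hε]
  rw [one_div, Real.log_inv, div_mul_eq_mul_div, div_le_iff₀ (by positivity)] at hn
  linarith

theorem exp_le_one_add_pow {s t : ℝ} {n k : ℕ} (hs : 0 < s) (hk : n * t ≤ k) :
    Real.exp (n * t * (s / (1 + s))) ≤ (1 + s) ^ k := by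
  rw [← Real.exp_log (show 0 < 1 + s by positivity), ← Real.exp_nat_mul, Real.exp_log (by positivity)]
  have h1 : s / (1 + s) ≤ Real.log (1 + s) := by
    have h := Real.one_sub_inv_le_log_of_pos (show 0 < 1 + s by positivity)
    have h2 : s / (1 + s) = 1 - (1 + s)⁻¹ := by field_simp; ring
    rwa [h2]
  have h2 : 0 ≤ s / (1 + s) := by positivity
  exact Real.exp_le_exp.mpr
    ((mul_le_mul_of_nonneg_right hk h2).trans (mul_le_mul_of_nonneg_left h1 k.cast_nonneg))

/-- The moment bound is used at `x = 1 + s` with `s = (b - a) / 4`. The summand `γ ^ 2 / 64`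
provides the strict inequality required of `c`, and costs half of the gain `γ ^ 2 / 32` found in
`h5`. -/
theorem chernoff_upper {a b w : ℝ} {n k : ℕ} (ha : 0 ≤ a) (hab : a < b) (hb : b ≤ 1)
    (hk : n * ((a + b) / 2) ≤ k)
    (hw : ∀ x c : ℝ, 1 ≤ x → 1 + (x - 1) * a < c → x ^ k * w ≤ c ^ n) :
    w ≤ Real.exp (-(n * ((b - a) ^ 2 / 128))) := by
  set γ := b - a with hγ
  have hγ0 : 0 < γ := sub_pos.mpr hab
  set s := γ / 4 with hs
  have hs0 : 0 < s := by positivity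
  have h1 := hw (1 + s) (1 + s * a + γ ^ 2 / 64) (by linarith)
    (by have : 0 < γ ^ 2 / 64 := by positivity
        linarith)
  have h2 : (1 + s * a + γ ^ 2 / 64) ^ n ≤ Real.exp (n * (s * a + γ ^ 2 / 64)) := by
    rw [Real.exp_nat_mul]
    refine pow_le_pow_left₀ (by positivity) ?_ n
    linarith [Real.add_one_le_exp (s * a + γ ^ 2 / 64)]
  have h3 := exp_le_one_add_pow (n := n) hs0 hk
  by_cases hw0 : w ≤ 0
  · exact hw0.trans (Real.exp_pos _).le
  have h4 := (mul_le_mul_of_nonneg_right h3 (not_le.mp hw0).le).trans (h1.trans h2)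
  rw [← le_div_iff₀' (Real.exp_pos _), ← Real.exp_sub] at h4
  refine h4.trans (Real.exp_le_exp.mpr ?_)
  have h5 : γ ^ 2 / 32 ≤ (a + b) / 2 * (s / (1 + s)) - s * a := by
    rw [mul_div_assoc', div_sub' (by positivity), le_div_iff₀ (by positivity)]
    have hb' : b = a + 4 * s := by rw [hs, hγ]; ring
    have hγ' : γ = 4 * s := by rw [hs]; ring
    rw [hγ', hb']
    have : s ≤ 1 / 4 := by linarith
    nlinarith [mul_pos hs0 hs0, mul_nonneg (mul_pos hs0 hs0).le (show 0 ≤ 1 - a - 4 * s by linarith)]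
  have h6 : 0 ≤ (n : ℝ) := n.cast_nonneg
  nlinarith [mul_le_mul_of_nonneg_left h5 h6, mul_nonneg h6 (sq_nonneg γ)]

/-- The moment bound is used at `y = 1 / (1 + s)` with `s = (b - a) / 8`. The mean `p` may lie `γ /
4` below `b`, which still leaves `γ / 4` above the threshold. -/
theorem chernoff_lower {a b p w : ℝ} {n : ℕ} (ha : 0 ≤ a) (hab : a < b) (hb : b ≤ 1)
    (hp : b - (b - a) / 4 ≤ p)
    (hw : ∀ y : ℝ, 0 < y → y ≤ 1 → y ^ (n * ((a + b) / 2)) * w ≤ (1 - p + y * p) ^ n)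
    (hp1 : p ≤ 1) : w ≤ Real.exp (-(n * ((b - a) ^ 2 / 128))) := by
  set γ := b - a with hγ
  have hγ0 : 0 < γ := sub_pos.mpr hab
  set s := γ / 8 with hs
  have hs0 : 0 < s := by positivity
  have hn : 0 ≤ (n : ℝ) := n.cast_nonneg
  have h1 := hw (1 + s)⁻¹ (by positivity) (inv_le_one_of_one_le₀ (by linarith))
  have hp0 : 0 ≤ p := by linarith
  have h2 : (1 - p + (1 + s)⁻¹ * p) ^ n ≤ Real.exp (n * (-(p * (s / (1 + s))))) := by
    rw [Real.exp_nat_mul]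
    refine pow_le_pow_left₀ (add_nonneg (by linarith) (by positivity)) ?_ n
    have h3 : 1 - p + (1 + s)⁻¹ * p = -(p * (s / (1 + s))) + 1 := by field_simp; ring
    rw [h3]
    exact Real.add_one_le_exp _
  have h3 : Real.exp (-(n * ((a + b) / 2) * s)) ≤ (1 + s)⁻¹ ^ (n * ((a + b) / 2)) := by
    rw [Real.rpow_def_of_pos (by positivity), Real.log_inv]
    refine Real.exp_le_exp.mpr ?_
    have h4 : Real.log (1 + s) ≤ s := by
      linarith [Real.log_le_sub_one_of_pos (show 0 < 1 + s by positivity)]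
    have h5 : 0 ≤ n * ((a + b) / 2) := mul_nonneg hn (by linarith)
    linarith [mul_le_mul_of_nonneg_left h4 h5]
  by_cases hw0 : w ≤ 0
  · exact hw0.trans (Real.exp_pos _).le
  have h4 := (mul_le_mul_of_nonneg_right h3 (not_le.mp hw0).le).trans (h1.trans h2)
  rw [← le_div_iff₀' (Real.exp_pos _), ← Real.exp_sub] at h4
  refine h4.trans (Real.exp_le_exp.mpr ?_)
  have h5 : γ ^ 2 / 128 ≤ p * (s / (1 + s)) - (a + b) / 2 * s := by
    rw [mul_div_assoc', div_sub' (by positivity), le_div_iff₀ (by positivity)]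
    have hb' : b = a + 8 * s := by rw [hs, hγ]; ring
    have hγ' : γ = 8 * s := by rw [hs]; ring
    rw [hγ', hb'] at hp
    rw [hγ', hb']
    have : s ≤ 1 / 8 := by linarith
    nlinarith [mul_le_mul_of_nonneg_right hp hs0.le, mul_pos hs0 hs0,
      mul_nonneg (mul_pos hs0 hs0).le (show 0 ≤ 1 - a - 8 * s by linarith)]
  nlinarith [mul_le_mul_of_nonneg_left h5 hn]

/-- Soundness of parallel repetition with a threshold. -/
theorem Interaction.value_repeatThreshold_le {V : Interaction} {a b : ℝ} (ha : 0 ≤ a) (hab : a < b)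
    (hb : b ≤ 1) (hV : V.value ≤ a) {n k : ℕ} (hk : n * ((a + b) / 2) ≤ k) :
    (V.repeatThreshold n k).value ≤ Real.exp (-(n * ((b - a) ^ 2 / 128))) := by
  refine (V.repeatThreshold n k).isLUB_value.2 ?_
  rintro _ ⟨B, rfl⟩
  exact chernoff_upper ha hab hb hk fun x c hx hc => winProb_repeatThreshold_le hV hx hc B

/-- Completeness of parallel repetition with a threshold. -/
theorem Interaction.le_value_repeatThreshold {V : Interaction} {a b : ℝ} (ha : 0 ≤ a) (hab : a < b)
    (hb : b ≤ 1) (hV : b ≤ V.value) {n k : ℕ} (hk : ∀ j < k, (j : ℝ) ≤ n * ((a + b) / 2)) :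
    1 - Real.exp (-(n * ((b - a) ^ 2 / 128))) ≤ (V.repeatThreshold n k).value := by
  -- The supremum need not be attained, so a strategy within `(b - a) / 4` of `b` is used.
  obtain ⟨_, ⟨B, rfl⟩, hB⟩ := exists_lt_of_lt_csSup (Set.range_nonempty _)
    (show b - (b - a) / 4 < V.value by linarith)
  have h := chernoff_lower ha hab hb hB.le
    (fun y hy hy1 => B.rpow_mul_one_sub_pow_winProb_le hy hy1 hk) B.winProb_mem.2
  have h1 := (V.repeatThreshold n k).isLUB_value.1 (Set.mem_range_self (B.pow n k))
  linarith

end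

end QIP


theorem mainTheorem2 (a b : ℝ) (ha : 0 ≤ a) (hab : a < b) (hb : b ≤ 1) :
    ∃ C : ℝ, 0 < C ∧
      ∀ {Str : Type*} (S : QIP.ProofSystem Str), S.HasSoundness a → S.HasCompleteness b →
        ∀ ε : ℝ, 0 < ε → ε < 1 → ∀ n : ℕ, C * Real.log (1 / ε) ≤ n →
          (S.repeatThreshold n ⌈n * (a + b) / 2⌉₊).HasSoundness ε ∧
          (S.repeatThreshold n ⌈n * (a + b) / 2⌉₊).HasCompleteness (1 - ε) := by
  have hγ : 0 < b - a := sub_pos.mpr hab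
  -- The reciprocal of the exponent per instance in both tail bounds.
  refine ⟨128 / (b - a) ^ 2, by positivity, fun S hs hc ε hε _ n hn => ?_⟩
  have h1 := QIP.exp_neg_mul_le hγ hε hn
  refine ⟨fun s hsn => ?_, fun s hsy => ?_⟩
  · refine (QIP.Interaction.value_repeatThreshold_le ha hab hb (hs s hsn) ?_).trans h1
    rw [← mul_div_assoc]
    exact Nat.le_ceil _
  · refine le_trans (by linarith) (QIP.Interaction.le_value_repeatThreshold ha hab hb (hc s hsy) ?_)
    intro j hj
    rw [← mul_div_assoc]
    -- A number of wins below the rounded-up threshold is also below the unrounded one, so rounding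
    -- costs nothing.
    exact (Nat.lt_ceil.mp hj).le
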